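/- Let $P\in\mathbb C[z]$ be a polynomial of degree $n\ge 1$, and let $P_1^{-1}(z),\dots,P_n^{-1}(z)$ be the single-valued continuous branches of the inverse of $P$ on a domain $U\subset\mathbb C$ containing no critical value of $P$ (on which such branches exist), with pairwise distinct values at each point of $U$. Let $G_P\subseteq S_n$ be the monodromy group of $P$, i.e. the group of permutations of the branches induced by loops in $\mathbb C$, based at a point of $U$, avoiding the critical values of $P$; assume the branches are numbered so that the permutation induced by a loop around infinity is the cycle $(1\,2\,\dots\,n)$. For $d\mid n$ let $V_d\subseteq\mathbb Q^n$ be the space of $d$-periodic vectors $(v_1,\dots,v_d,v_1,\dots,v_d,\dots,v_1,\dots,v_d)$, and let $D(G_P)$ be the set of divisors $d$ of $n$ such that $V_d$ is invariant under the permutation action of $G_P$ on $\mathbb Q^n$. Say that $d\in D(G_P)$ covers $\tilde d\in D(G_P)$ if $\tilde d\mid d$, $\tilde d<d$ and there is no $l\in D(G_P)$ with $\tilde d<l<d$, $\tilde d\mid l$, $l\mid d$. For $d\in D(G_P)$ let $\Psi_d$ be the set of $r\in\{1,\dots,n\}$ such that $n/d$ divides $r$, but $n/\tilde d$ does not divide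 $r$ for any $\tilde d\in D(G_P)$ covered by $d$. Put $\vec w_r=(1,\varepsilon^r,\varepsilon^{2r},\dots,\varepsilon^{(n-1)r})\in\mathbb C^n$ with $\varepsilon=e^{2\pi i/n}$, and let $(\cdot,\cdot)$ be the standard Hermitian product on $\mathbb C^n$. Let $\delta(z)=\sum_{i=1}^n v_iP_i^{-1}(z)$ be a cycle with coefficient vector $\vec\delta=(v_1,\dots,v_n)\in\mathbb Q^n$, and let $Q\in\mathbb C[z]$ be a non-zero polynomial. Suppose that $$\int_{\delta(z)}Q:=\sum_{i=1}^n v_i\,Q(P_i^{-1}(z))\equiv 0\quad\text{on }U,$$ and that for every $d\in D(G_P)$ with $d\ne 1$ there exists $r\in\Psi_d$ such that $(\vec\delta,\vec w_r)\neq 0$. Then $Q$ is a polynomial in $P$, i.e. $Q=R\circ P$ for some $R\in\mathbb C[z]$, and the cycle $\delta(z)$ is reduced, i.e. $\sum_{i=1}^n v_i=0$. -/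

import Mathlib

open Polynomial

namespace AbelianIntegral

/-! ### Regular values, branches of the inverse function, monodromy -/

/-- The set of (finite) critical values of the polynomial map `P : ℂ → ℂ`. -/
def criticalValues (P : ℂ[X]) : Set ℂ :=
  {c | ∃ x : ℂ, P.eval x = c ∧ P.derivative.eval x = 0}

/-- The set of regular values of `P`, that is, `ℂ ∖ Δ` with `Δ` the set of critical values. -/
def regularValues (P : ℂ[X]) : Set ℂ := (criticalValues P)ᶜ

/-- A numbered system `P₁⁻¹(z), …, Pₙ⁻¹(z)` of single-valued continuous branches of the inverse
of `P` on a domain consisting of regular values, with a base point in the domain. The values of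
the branches at a point are pairwise distinct; when `n = deg P` they hence are the whole fibre.
The indices are `0, …, n - 1` instead of `1, …, n`. -/
structure Branches (P : ℂ[X]) (n : ℕ) where
  domain : Set ℂ
  isOpen_domain : IsOpen domain
  isConnected_domain : IsConnected domain
  domain_subset : domain ⊆ regularValues P
  base : ℂ
  base_mem : base ∈ domain
  branch : Fin n → ℂ → ℂ
  continuousOn_branch : ∀ i, ContinuousOn (branch i) domain
  eval_branch : ∀ i, ∀ z ∈ domain, P.eval (branch i z) = z
  injective_branch : ∀ z ∈ domain, Function.Injective fun i => branch i z

variable {P : ℂ[X]} {n : ℕ}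

/-- The permutation `σ` of the indices is the one induced by the loop `γ`: lifting `γ` through `P`
from the point `Pᵢ⁻¹(z₀)` of the fibre over the base point `z₀` one arrives at
the point `P_{σ i}⁻¹(z₀)`, for every `i`. -/
def Branches.IsMonodromy (b : Branches P n) (γ : Path b.base b.base)
    (σ : Equiv.Perm (Fin n)) : Prop :=
  ∀ i, ∃ Γ : Path (b.branch i b.base) (b.branch (σ i) b.base), ∀ t, P.eval (Γ t) = γ t

/-- The monodromy group `G_P` of `P`, as a group of permutations of the indices of the branches:
all permutations induced by loops at the base point that avoid the critical values. -/
def Branches.monodromyGroup (b : Branches P n) : Subgroup (Equiv.Perm (Fin n)) where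
  carrier := {σ | ∃ γ : Path b.base b.base, (∀ t, γ t ∈ regularValues P) ∧ b.IsMonodromy γ σ}
  one_mem' := ⟨Path.refl _, fun _ => b.domain_subset b.base_mem, fun i =>
    ⟨Path.refl _, fun _ => b.eval_branch i _ b.base_mem⟩⟩
  mul_mem' := by
    rintro σ τ ⟨γ, hγ, hσ⟩ ⟨γ', hγ', hτ⟩
    refine ⟨γ'.trans γ, fun t => ?_, fun i => ?_⟩
    · rw [Path.trans_apply]
      split_ifs
      exacts [hγ' _, hγ _]
    · obtain ⟨Γ', h'⟩ := hτ i
      obtain ⟨Γ, h⟩ := hσ (τ i)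
      have key : ∀ t, P.eval ((Γ'.trans Γ) t) = (γ'.trans γ) t := fun t => by
        rw [Path.trans_apply, Path.trans_apply]
        split_ifs
        exacts [h' _, h _]
      exact ⟨Γ'.trans Γ, key⟩
  inv_mem' := by
    rintro σ ⟨γ, hγ, hσ⟩
    refine ⟨γ.symm, fun t => hγ _, fun i => ?_⟩
    obtain ⟨Γ, h⟩ := hσ (σ⁻¹ i)
    refine ⟨Γ.symm.cast (by simp) rfl, fun t => ?_⟩
    simpa using h (unitInterval.symm t)

/-- The circle `t ↦ w · exp(2πi k t)`, `0 ≤ t ≤ 1`, centred at the origin, starting at `w`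
and run through `k` times counterclockwise (so clockwise once for `k = -1`). -/
noncomputable def circlePath (w : ℂ) (k : ℤ) : Path w w where
  toFun t := w * Complex.exp (k * (2 * Real.pi * Complex.I) * ((t : ℝ) : ℂ))
  continuous_toFun := by fun_prop
  source' := by simp
  target' := by simp [Complex.exp_int_mul_two_pi_mul_I]

/-- `γ` is a loop around infinity: it joins `z₀`, inside the set of regular values, to a point `w`
of absolute value greater than that of every critical value, then runs once, in one of the two
directions, through the circle centred at the origin through `w`, and returns on the same way. -/
def IsLoopAroundInfinity (P : ℂ[X]) {z₀ : ℂ} (γ : Path z₀ z₀) : Prop :=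
  ∃ (w : ℂ) (α : Path z₀ w) (k : ℤ),
    0 < ‖w‖ ∧ (∀ c ∈ criticalValues P, ‖c‖ < ‖w‖) ∧ (∀ t, α t ∈ regularValues P) ∧
    (k = 1 ∨ k = -1) ∧ γ = (α.trans (circlePath w k)).trans α.symm

/-- The numeration of the branches is such that the permutation induced by
a loop around infinity is the cycle `(1 2 … n)`. -/
def Branches.IsStandard (b : Branches P n) : Prop :=
  ∃ γ : Path b.base b.base, IsLoopAroundInfinity P γ ∧ b.IsMonodromy γ (finRotate n)

/-! ### Zero-dimensional cycles and Abelian integrals -/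

/-- The Abelian integral `∫_{δ(z)} Q = ∑ vᵢ Q(Pᵢ⁻¹(z))` along the
cycle `δ(z) = ∑ vᵢ Pᵢ⁻¹(z)` with vector of coefficients `v ∈ ℚⁿ`. -/
noncomputable def Branches.integral (b : Branches P n) (v : Fin n → ℚ) (Q : ℂ[X]) (z : ℂ) : ℂ :=
  ∑ i, (v i : ℂ) * Q.eval (b.branch i z)

/-- The cycle with vector of coefficients `v` lies in the reduced zeroth homology group. -/
def IsReduced (v : Fin n → ℚ) : Prop := ∑ i, v i = 0

/-! ### The lattice `D(G)`, the sets `Ψ_d`, and the vectors `w_k` -/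

/-- The space `V_d` of `d`-periodic vectors of `ℚⁿ`. -/
def periodicVectors (n d : ℕ) : Submodule ℚ (Fin n → ℚ) where
  carrier := {v | ∀ i j : Fin n, (i : ℕ) ≡ j [MOD d] → v i = v j}
  zero_mem' := fun _ _ _ => rfl
  add_mem' := fun hv hw i j h => by simp [hv i j h, hw i j h]
  smul_mem' := fun c v hv i j h => by simp [hv i j h]

/-- The set `D(G)` of all divisors `d` of `n` such that `V_d` is invariant under the
permutation representation of `G` on `ℚⁿ`, in which `σ` maps `v` to `v ∘ σ⁻¹`. -/
def invariantDivisors (G : Subgroup (Equiv.Perm (Fin n))) : Set ℕ :=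
  {d | d ∣ n ∧ ∀ σ ∈ G, ∀ v ∈ periodicVectors n d, v ∘ ⇑σ⁻¹ ∈ periodicVectors n d}

/-- In a set `D` of natural numbers, `d` covers `d'`. -/
def DivisorCovers (D : Set ℕ) (d d' : ℕ) : Prop :=
  d ∈ D ∧ d' ∈ D ∧ d' ∣ d ∧ d' < d ∧ ¬ ∃ l ∈ D, d' < l ∧ l < d ∧ d' ∣ l ∧ l ∣ d

/-- The set `Ψ_d` of all `r ∈ {1, …, n}` divisible by `n / d` but not by `n / d'`
for any `d' ∈ D(G)` covered by `d`. -/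
def psiSet (G : Subgroup (Equiv.Perm (Fin n))) (d : ℕ) : Set ℕ :=
  {r | 1 ≤ r ∧ r ≤ n ∧ n / d ∣ r ∧
    ∀ d', DivisorCovers (invariantDivisors G) d d' → ¬ n / d' ∣ r}

/-- The vector `w_k = (1, εᵏ, ε²ᵏ, …, ε⁽ⁿ⁻¹⁾ᵏ)` with `ε = exp(2πi / n)`. -/
noncomputable def rootVector (n k : ℕ) : Fin n → ℂ :=
  fun j => Complex.exp (2 * Real.pi * Complex.I / n) ^ ((j : ℕ) * k)

/-- The standard Hermitian product `(v, w) = ∑ vᵢ w̄ᵢ` of a rational and a complex vector. -/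
noncomputable def hermitian (v : Fin n → ℚ) (w : Fin n → ℂ) : ℂ :=
  ∑ i, (v i : ℂ) * starRingEnd ℂ (w i)

end AbelianIntegral

/-! Analytic continuation along loops shows that, near the base point, the vector `q = (Q(Pᵢ⁻¹(z)))`
is annihilated by every translate of `δ` under the monodromy group `G`. As `G` contains the full
cycle, the indices become `ZMod n` and the complex span of the translates is shift-invariant, hence
spanned by the characters whose frequencies occur in some translate. If every non-zero frequency
occurs, `q` is constant (`ZMod.eq_of_forall_sum_eq_zero`), so `Q` is constant on the fibres of `P`
over an open set, and repeated division by `P - w` gives `Q = R ∘ P`. The integral is then `(∑ vᵢ)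
R(z)` with `R ≠ 0`, so the cycle is reduced.

To see that all non-zero frequencies occur, partition them by the integral Fourier multipliers that
commute with `G` and are invariant under units. Permutations respect pointwise products, so these
multipliers are closed under convolution and the partition is a rational Schur ring
(`isRationalSchurRing_spectralSetoid`). The frequencies missing from all translates form a union of
classes (`isSaturated_fourierCoeffComp_eq_zero`). The core is `exists_rel_forall_mem_zmultiples`: a
class contains a generator of the subgroup it generates. Elements of equal order share a class, so a
class is determined by the order of that subgroup, and the subgroups that are unions of classes
correspond to `D(G)` (`isSaturated_annihilator_iff`). Hence each `Ψ_d` lies in one class, and a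
single occurring frequency per `d ≠ 1` suffices. -/

theorem Nat.exists_modEq_coprime {d N k : ℕ} (hN : N ≠ 0) (hd : d ∣ N) (hk : k.Coprime d) :
    ∃ k', k' ≡ k [MOD d] ∧ k'.Coprime N := by
  have : NeZero N := ⟨hN⟩
  obtain ⟨u, hu⟩ := ZMod.unitsMap_surjective hd (ZMod.unitOfCoprime k hk)
  refine ⟨(u : ZMod N).val, ?_, ZMod.val_coe_unit_coprime u⟩
  rw [← ZMod.natCast_eq_natCast_iff]
  have := congrArg Units.val hu
  rw [ZMod.unitsMap_val, ZMod.coe_unitOfCoprime] at this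
  rw [← this, ZMod.natCast_val]

/-! ### Rational Schur rings: saturated sets and Schur's p-th power argument -/

/-- A partition of a finite abelian group with singleton class `{0}`, stable under multiplication
by integers prime to the order of the group, and such that the integral functions that are
constant on the classes are closed under convolution. -/
structure IsRationalSchurRing {C : Type*} [AddCommGroup C] [Fintype C] (R : Setoid C) : Prop where
  eq_zero : ∀ x, R 0 x → x = 0
  nsmul : ∀ (x : C) (k : ℕ), k.Coprime (Nat.card C) → R x (k • x)
  conv : ∀ f g : C → ℤ, (∀ x y, R x y → f x = f y) → (∀ x y, R x y → g x = g y) →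
    ∀ x y, R x y → ∑ a, f a * g (x - a) = ∑ a, f a * g (y - a)

/-- The set `X` is a union of classes of `R`. -/
def Setoid.IsSaturated {C : Type*} (R : Setoid C) (X : Set C) : Prop :=
  ∀ x y, R x y → x ∈ X → y ∈ X

namespace Setoid.IsSaturated
variable {C : Type*} {R : Setoid C} {X Y : Set C}

theorem mem_iff (h : R.IsSaturated X) {x y : C} (hxy : R x y) : x ∈ X ↔ y ∈ X :=
  ⟨h x y hxy, h y x (R.symm' hxy)⟩

theorem compl (h : R.IsSaturated X) : R.IsSaturated Xᶜ :=
  fun _ _ hxy hx hy => hx ((h.mem_iff hxy).2 hy)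

theorem union (h : R.IsSaturated X) (h' : R.IsSaturated Y) : R.IsSaturated (X ∪ Y) :=
  fun x y hxy hx => hx.imp (h x y hxy) (h' x y hxy)

theorem setOf_rel (x : C) : R.IsSaturated {y | R x y} := fun _ _ h h' => R.trans' h' h

end Setoid.IsSaturated

theorem exists_nsmul_eq_of_mem_zmultiples {C : Type*} [AddCommGroup C] [Finite C] {a b : C}
    (h : b ∈ AddSubgroup.zmultiples a) : ∃ k : ℕ, k • a = b := by
  classical
  have := (mem_zmultiples_iff_mem_range_addOrderOf (x := a) (y := b)).1 h
  obtain ⟨k, -, hk⟩ := Finset.mem_image.1 this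
  exact ⟨k, hk⟩

/-- The multiples of `a` already exhaust the maximal number of solutions of `addOrderOf a • x = 0`
in a cyclic group. -/
theorem IsAddCyclic.mem_zmultiples_of_addOrderOf_nsmul {C : Type*} [AddCommGroup C] [Finite C]
    [IsAddCyclic C] {a b : C} (h : addOrderOf a • b = 0) : b ∈ AddSubgroup.zmultiples a := by
  classical
  have := Fintype.ofFinite C
  have h1 := IsAddCyclic.card_nsmul_eq_zero_le (α := C) (addOrderOf_pos a)
  have h2 : (Finset.univ.filter fun x : C => x ∈ AddSubgroup.zmultiples a) ⊆
      Finset.univ.filter fun x : C => addOrderOf a • x = 0 := by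
    intro x hx
    simp only [Finset.mem_filter, Finset.mem_univ, true_and] at hx ⊢
    obtain ⟨k, rfl⟩ := exists_nsmul_eq_of_mem_zmultiples hx
    rw [smul_comm, addOrderOf_nsmul_eq_zero, smul_zero]
  have h3 : (Finset.univ.filter fun x : C => x ∈ AddSubgroup.zmultiples a).card = addOrderOf a := by
    rw [← Nat.card_zmultiples, Nat.card_eq_fintype_card, Fintype.card_subtype]
  have h4 := Finset.eq_of_subset_of_card_le h2 (h3 ▸ h1)
  have : b ∈ Finset.univ.filter fun x : C => addOrderOf a • x = 0 := by simpa using h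
  rw [← h4] at this
  simpa using this

namespace IsRationalSchurRing

variable {C : Type*} [AddCommGroup C] [Fintype C] {R : Setoid C}

/-- Elements of equal order are multiples of each other by a factor prime to that order; the factor
lifts to one prime to the order of `C`. -/
theorem rel_of_addOrderOf_eq [IsAddCyclic C] (h : IsRationalSchurRing R) {a b : C}
    (hab : addOrderOf a = addOrderOf b) : R a b := by
  have hb : b ∈ AddSubgroup.zmultiples a :=
    IsAddCyclic.mem_zmultiples_of_addOrderOf_nsmul (by rw [hab, addOrderOf_nsmul_eq_zero])
  obtain ⟨k, rfl⟩ := exists_nsmul_eq_of_mem_zmultiples hb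
  have hk : k.Coprime (addOrderOf a) := by
    rw [addOrderOf_nsmul] at hab
    have h0 := addOrderOf_pos a
    have hd := Nat.gcd_dvd_left (addOrderOf a) k
    have := Nat.div_mul_cancel hd
    rw [← hab] at this
    rw [Nat.coprime_comm]
    exact Nat.eq_of_mul_eq_mul_left h0 (by rw [this, mul_one])
  obtain ⟨k', h1, h2⟩ := Nat.exists_modEq_coprime Nat.card_pos.ne' (addOrderOf_dvd_natCard a) hk
  have := h.nsmul a k' h2
  rwa [nsmul_eq_nsmul_iff_modEq.2 h1] at this

theorem isSaturated_neg (h : IsRationalSchurRing R) {X : Set C} (hX : R.IsSaturated X) :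
    R.IsSaturated (-X) := by
  have key : ∀ x, R x (-x) := fun x => by
    have := h.nsmul x (Nat.card C - 1) (by
      have := Nat.card_pos (α := C)
      rw [Nat.coprime_comm, Nat.coprime_self_sub_right this]
      simp)
    have e : (Nat.card C - 1) • x = -x := by
      rw [eq_neg_iff_add_eq_zero, ← succ_nsmul, Nat.sub_add_cancel Nat.card_pos]
      exact card_nsmul_eq_zero'
    rwa [e] at this
  intro x y hxy hx
  exact hX (-x) (-y) (R.trans' (R.symm' (key x)) (R.trans' hxy (key y))) hx

open Pointwise in
-- The convolution of the two indicators counts representations as a sum, so its support is the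
-- sumset.
theorem isSaturated_add (h : IsRationalSchurRing R) {X Y : Set C} (hX : R.IsSaturated X)
    (hY : R.IsSaturated Y) : R.IsSaturated (X + Y) := by
  classical
  have key : ∀ x, x ∈ X + Y ↔
      ∑ a, (if a ∈ X then (1 : ℤ) else 0) * (if x - a ∈ Y then (1 : ℤ) else 0) ≠ 0 := by
    intro x
    rw [ne_eq, Finset.sum_eq_zero_iff_of_nonneg (fun a _ => by split_ifs <;> simp)]
    simp only [Set.mem_add, Finset.mem_univ, true_imp_iff, mul_eq_zero, ite_eq_right_iff,
      one_ne_zero, imp_false, not_forall, not_or, not_not]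
    constructor
    · rintro ⟨a, ha, b, hb, rfl⟩
      exact ⟨a, ha, by simpa using hb⟩
    · rintro ⟨a, ha, hb⟩
      exact ⟨a, ha, _, hb, by simp⟩
  intro x y hxy
  rw [key, key, h.conv (fun a => if a ∈ X then 1 else 0) (fun a => if a ∈ Y then 1 else 0) _ _ x y
    hxy]
  · exact id
  all_goals
    intro x y hxy
    simp only [hX.mem_iff hxy, hY.mem_iff hxy]

theorem isSaturated_closure (h : IsRationalSchurRing R) {X : Set C} (hX : R.IsSaturated X) :
    R.IsSaturated (AddSubgroup.closure X : Set C) := by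
  suffices ∀ x ∈ AddSubgroup.closure X, ∀ y, R x y → y ∈ AddSubgroup.closure X from
    fun x y hxy hx => this x hx y hxy
  intro x hx
  induction hx using AddSubgroup.closure_induction with
  | mem x hx => exact fun y hy => AddSubgroup.subset_closure (hX x y hy hx)
  | zero => exact fun y hy => by rw [h.eq_zero y hy]; exact zero_mem _
  | add a b _ _ ha hb =>
    intro y hy
    obtain ⟨a', ha', b', hb', rfl⟩ := h.isSaturated_add (Setoid.IsSaturated.setOf_rel a)
      (Setoid.IsSaturated.setOf_rel b) _ _ hy ⟨a, R.refl' a, b, R.refl' b, rfl⟩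
    exact add_mem (ha a' ha') (hb b' hb')
  | neg a _ ha =>
    intro y hy
    have := h.isSaturated_neg (Setoid.IsSaturated.setOf_rel a) _ _ hy (by simp)
    exact neg_mem_iff.1 (ha _ this)

theorem conv_zmod (h : IsRationalSchurRing R) {p : ℕ} [NeZero p] {f g : C → ZMod p}
    (hf : ∀ x y, R x y → f x = f y) (hg : ∀ x y, R x y → g x = g y) {x y : C} (hxy : R x y) :
    ∑ a, f a * g (x - a) = ∑ a, f a * g (y - a) := by
  have := h.conv (fun a => ((f a).val : ℤ)) (fun a => ((g a).val : ℤ))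
    (fun x y hxy => by rw [hf x y hxy]) (fun x y hxy => by rw [hg x y hxy]) x y hxy
  simpa using congrArg (Int.cast : ℤ → ZMod p) this

open Classical in
-- In the group algebra over `ZMod p`, Frobenius turns the `p`-th power of `∑ a ∈ X` into the sum of
-- the elements `p • a`. The counts are thus coefficients of a convolution power.
theorem card_filter_nsmul_eq (h : IsRationalSchurRing R) {p : ℕ} [Fact p.Prime] {X : Set C}
    (hX : R.IsSaturated X) {x y : C} (hxy : R x y) :
    ((Finset.univ.filter fun a => a ∈ X ∧ p • a = x).card : ZMod p) =
      (Finset.univ.filter fun a => a ∈ X ∧ p • a = y).card := by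
  set F : AddMonoidAlgebra (ZMod p) C :=
    ∑ a ∈ Finset.univ.filter (· ∈ X), AddMonoidAlgebra.single a 1 with hF
  have hFc : ∀ x, F.coeff x = if x ∈ X then 1 else 0 := by
    intro x
    simp [hF, AddMonoidAlgebra.coeff_sum, Finsupp.finsetSum_apply, Finsupp.single_apply]
  have hmul : ∀ (A B : AddMonoidAlgebra (ZMod p) C) (x : C),
      (A * B).coeff x = ∑ a, A.coeff a * B.coeff (x - a) := by
    intro A B x
    rw [AddMonoidAlgebra.coeff_mul_antidiag A B x
      (Finset.univ.image fun a => (a, x - a)) (by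
        rintro ⟨u, v⟩
        simp only [Finset.mem_image, Finset.mem_univ, true_and, Prod.mk.injEq]
        constructor
        · rintro ⟨a, rfl, rfl⟩; simp
        · rintro rfl; exact ⟨u, rfl, by simp⟩)]
    rw [Finset.sum_image (by intro a _ b _ hab; exact (Prod.mk.inj hab).1)]
  have hpow : ∀ k : ℕ, ∀ x y, R x y → (F ^ k).coeff x = (F ^ k).coeff y := by
    intro k
    induction k with
    | zero =>
      intro x y hxy
      rw [pow_zero, AddMonoidAlgebra.one_def, AddMonoidAlgebra.coeff_single,
        Finsupp.single_apply, Finsupp.single_apply]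
      have : 0 = x ↔ 0 = y := by
        constructor
        · rintro rfl; exact (h.eq_zero y hxy).symm
        · rintro rfl; exact (h.eq_zero x (R.symm' hxy)).symm
      simp only [this]
    | succ k ih =>
      intro x y hxy
      rw [pow_succ, hmul, hmul]
      refine h.conv_zmod ih (fun x y hxy => ?_) hxy
      rw [hFc, hFc]
      simp only [hX.mem_iff hxy]
  have hFp : ∀ x, (F ^ p).coeff x = (Finset.univ.filter fun a => a ∈ X ∧ p • a = x).card := by
    intro x
    have : CharP (AddMonoidAlgebra (ZMod p) C) p :=
      (Algebra.charP_iff (ZMod p) _ p).1 inferInstance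
    rw [hF, sum_pow_char p]
    simp only [AddMonoidAlgebra.single_pow, one_pow]
    rw [AddMonoidAlgebra.coeff_sum, Finsupp.finsetSum_apply]
    simp only [AddMonoidAlgebra.coeff_single, Finsupp.single_apply]
    rw [Finset.sum_boole, Finset.filter_filter]
  rw [← hFp, ← hFp, hpow p x y hxy]

end IsRationalSchurRing

/-! ### Quotients of rational Schur rings -/

/-- The partition of `C ⧸ S` whose invariant functions are those with invariant pullback. -/
def Setoid.quotientAddSubgroup {C : Type*} [AddCommGroup C] (R : Setoid C) (S : AddSubgroup C) :
    Setoid (C ⧸ S) where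
  r a b := ∀ f : C ⧸ S → ℤ, (∀ x y : C, R x y → f x = f y) → f a = f b
  iseqv := ⟨fun _ _ _ => rfl, fun h f hf => (h f hf).symm, fun h h' f hf => (h f hf).trans (h' f hf)⟩

theorem Setoid.quotientAddSubgroup_rel {C : Type*} [AddCommGroup C] {R : Setoid C}
    {S : AddSubgroup C} {a b : C ⧸ S} : R.quotientAddSubgroup S a b ↔
      ∀ f : C ⧸ S → ℤ, (∀ x y : C, R x y → f x = f y) → f a = f b := Iff.rfl

theorem Setoid.eq_zero_of_quotientAddSubgroup_rel {C : Type*} [AddCommGroup C] {R : Setoid C}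
    {S : AddSubgroup C}
    (hS : R.IsSaturated (S : Set C)) (a : C ⧸ S) (ha : R.quotientAddSubgroup S 0 a) : a = 0 := by
  classical
  have := Setoid.quotientAddSubgroup_rel.1 ha (fun c => if c = 0 then 1 else 0) (fun x y hxy => by
    have : x ∈ S ↔ y ∈ S := hS.mem_iff hxy
    simp only [QuotientAddGroup.eq_zero_iff, this])
  by_contra hne
  rw [if_pos rfl, if_neg hne] at this
  exact one_ne_zero this

theorem AddMonoidHom.sum_comp_of_surjective {A B : Type*} [AddGroup A] [AddGroup B] [Fintype A]
    [Fintype B] (φ : A →+ B) (hφ : Function.Surjective φ) :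
    ∃ c : ℤ, c ≠ 0 ∧ ∀ F : B → ℤ, ∑ a, F (φ a) = c * ∑ b, F b := by
  classical
  refine ⟨(Finset.univ.filter fun a => φ a = 0).card, ?_, fun F => ?_⟩
  · rw [Nat.cast_ne_zero, ← Nat.pos_iff_ne_zero, Finset.card_pos]
    exact ⟨0, by simp⟩
  · rw [← Finset.sum_fiberwise Finset.univ φ, Finset.mul_sum]
    refine Finset.sum_congr rfl fun b _ => ?_
    rw [Finset.sum_congr rfl (g := fun _ => F b) (by simp +contextual), Finset.sum_const,
      nsmul_eq_mul, card_fiber_eq_of_mem_range φ (hφ b) (hφ 0)]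

namespace IsRationalSchurRing

universe u
variable {C : Type u} [AddCommGroup C] [Fintype C] {R : Setoid C}

theorem quotient_nsmul (h : IsRationalSchurRing R) {S : AddSubgroup C} (a : C ⧸ S) (k : ℕ)
    (hk : k.Coprime (Nat.card (C ⧸ S))) : R.quotientAddSubgroup S a (k • a) := by
  obtain ⟨a, rfl⟩ := QuotientAddGroup.mk_surjective a
  obtain ⟨k', h1, h2⟩ := Nat.exists_modEq_coprime Nat.card_pos.ne'
    (AddSubgroup.card_quotient_dvd_card S) hk
  have e : k • (a : C ⧸ S) = ((k' • a : C) : C ⧸ S) :=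
    nsmul_eq_nsmul_iff_modEq.2 (h1.symm.of_dvd (addOrderOf_dvd_natCard _))
  rw [e, Setoid.quotientAddSubgroup_rel]
  exact fun f hf => hf _ _ (h.nsmul a k' h2)

/-- All fibres of `C → C ⧸ S` have the same size, so up to a non-zero factor the convolution on the
quotient is that of the pullbacks. -/
theorem quotient_conv (h : IsRationalSchurRing R) {S : AddSubgroup C} [Fintype (C ⧸ S)]
    {f g : C ⧸ S → ℤ} (hf : ∀ x y : C, R x y → f x = f y) (hg : ∀ x y : C, R x y → g x = g y)
    {x y : C} (hxy : R x y) :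
    ∑ a : C ⧸ S, f a * g (x - a) = ∑ a : C ⧸ S, f a * g (y - a) := by
  obtain ⟨c, hc, hsum⟩ := AddMonoidHom.sum_comp_of_surjective (QuotientAddGroup.mk' S)
    (QuotientAddGroup.mk'_surjective S)
  refine mul_left_cancel₀ hc ?_
  rw [← hsum, ← hsum]
  exact h.conv (fun a => f a) (fun a => g a) hf hg x y hxy

theorem quotient (h : IsRationalSchurRing R) {S : AddSubgroup C} [Fintype (C ⧸ S)]
    (hS : R.IsSaturated (S : Set C)) : IsRationalSchurRing (R.quotientAddSubgroup S) :=
  ⟨Setoid.eq_zero_of_quotientAddSubgroup_rel hS, quotient_nsmul h, fun f g hf hg _ _ hab =>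
    Setoid.quotientAddSubgroup_rel.1 hab (fun c => ∑ a, f a * g (c - a)) fun _ _ hxy =>
      h.quotient_conv
        (fun x y hxy => hf x y (Setoid.quotientAddSubgroup_rel.2 fun _ hF => hF x y hxy))
        (fun x y hxy => hg x y (Setoid.quotientAddSubgroup_rel.2 fun _ hF => hF x y hxy)) hxy⟩

open Classical in
-- The fibre is a coset of the `p`-torsion subgroup, whose order is divisible by `p` by Cauchy's
-- theorem.
theorem card_filter_nsmul_eq_zero {p : ℕ} [hp : Fact p.Prime] (hpC : p ∣ Nat.card C) (z : C) :
    ((Finset.univ.filter fun a : C => p • a = p • z).card : ZMod p) = 0 := by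
  have h1 := AddMonoidHom.card_fiber_eq_of_mem_range (nsmulAddMonoidHom p : C →+ C) (x := p • z) (y := 0)
    ⟨z, rfl⟩ ⟨0, by simp⟩
  simp only [nsmulAddMonoidHom_apply] at h1
  rw [h1, CharP.cast_eq_zero_iff (ZMod p) p]
  obtain ⟨t, ht⟩ := exists_prime_addOrderOf_dvd_card' p hpC
  have h2 : AddSubgroup.zmultiples t ≤ (nsmulAddMonoidHom p : C →+ C).ker := by
    rw [AddSubgroup.zmultiples_le, AddMonoidHom.mem_ker, nsmulAddMonoidHom_apply, ← ht,
      addOrderOf_nsmul_eq_zero]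
  have h3 := AddSubgroup.card_dvd_of_le h2
  rw [Nat.card_zmultiples, ht] at h3
  convert h3
  rw [Nat.card_eq_fintype_card, Fintype.card_subtype]
  simp [AddMonoidHom.mem_ker]

open Classical in
/-- If `O` is a class and `U` is the set of `y` such that the number of solutions of `p a = y` in
`O` is not divisible by `p`, then `O ∪ U` is stable under translation by `p`-torsion. -/
theorem mem_union_of_nsmul_eq [IsAddCyclic C] (h : IsRationalSchurRing R) {p : ℕ}
    [hp : Fact p.Prime] (hpC : p ∣ Nat.card C) {O U : Set C} (hO : R.IsSaturated O)
    (hU : U = {y | ((Finset.univ.filter fun a => a ∈ O ∧ p • a = y).card : ZMod p) ≠ 0})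
    (hOU : ∀ z ∈ O, z ∉ U) {z z' : C} (hz : p • z = p • z') (hzV : z ∈ O ∪ U) : z' ∈ O ∪ U := by
  have hUs : R.IsSaturated U := by
    intro x y hxy hx
    rw [hU, Set.mem_ofPred_eq] at hx ⊢
    rwa [← h.card_filter_nsmul_eq hO hxy]
  have hdich : ∀ a : C, p ∣ addOrderOf a → addOrderOf a = p * addOrderOf (p • a) := by
    intro a ha
    rw [addOrderOf_nsmul' a hp.out.ne_zero, Nat.gcd_eq_right ha, Nat.mul_div_cancel' ha]
  have hdich' : ∀ a : C, ¬ p ∣ addOrderOf a → addOrderOf a = addOrderOf (p • a) := by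
    intro a ha
    rw [addOrderOf_nsmul' a hp.out.ne_zero,
      Nat.coprime_comm.1 ((Nat.Prime.coprime_iff_not_dvd hp.out).2 ha), Nat.div_one]
  have hall : ∀ y : C, (∀ a, p • a = p • y → a ∈ O) → p • y ∉ U := by
    intro y hy hyU
    rw [hU, Set.mem_ofPred_eq] at hyU
    apply hyU
    rw [← card_filter_nsmul_eq_zero hpC y]
    congr 3
    ext a
    exact and_iff_right_of_imp (hy a)
  have hnone : ∀ y : C, (∀ a, p • a = p • y → a ∉ O) → p • y ∉ U := by
    intro y hy hyU
    rw [hU, Set.mem_ofPred_eq] at hyU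
    apply hyU
    rw [Finset.card_eq_zero.2, Nat.cast_zero]
    rw [Finset.filter_eq_empty_iff]
    rintro a - ⟨h1, h2⟩
    exact hy a h2 h1
  have hUimg : ∀ u ∈ U, ∃ a, p • a = u := by
    intro u hu
    rw [hU, Set.mem_ofPred_eq] at hu
    by_contra! hcon
    apply hu
    rw [Finset.card_eq_zero.2, Nat.cast_zero]
    rw [Finset.filter_eq_empty_iff]
    rintro a - ⟨-, h2⟩
    exact hcon a h2
  have hsame : ∀ y : C, p ∣ addOrderOf (p • y) → ∀ a b : C, p • a = p • y → p • b = p • y →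
      addOrderOf a = addOrderOf b := by
    have : ∀ y : C, p ∣ addOrderOf (p • y) → ∀ a : C, p • a = p • y →
        addOrderOf a = p * addOrderOf (p • y) := by
      intro y hy a ha
      rw [← ha]
      refine hdich a ?_
      by_contra hcon
      exact hcon (by rw [hdich' a hcon, ha]; exact hy)
    intro y hy a b ha hb
    rw [this y hy a ha, this y hy b hb]
  have hUord : ∀ u ∈ U, ¬ p ∣ addOrderOf u := by
    intro u hu hpu
    obtain ⟨a, rfl⟩ := hUimg u hu
    by_cases ha : a ∈ O
    · exact hall a (fun b hb => hO a b (h.rel_of_addOrderOf_eq (hsame a hpu a b rfl hb)) ha) hu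
    · exact hnone a (fun b hb hbO =>
        ha (hO b a (h.rel_of_addOrderOf_eq (hsame a hpu b a hb rfl)) hbO)) hu
  -- If `p` divides the order of `p • z`, the whole fibre has one order, so it lies in `O` or misses
  -- it, and it is disjoint from `U`.
  by_cases hm : p ∣ addOrderOf (p • z)
  · rcases hzV with hzO | hzU
    · exact Or.inl (hO z z' (h.rel_of_addOrderOf_eq (hsame z hm z z' rfl hz.symm)) hzO)
    · have := hUord z hzU
      rw [hdich' z this] at this
      exact absurd hm this
  -- Otherwise the fibre has exactly one element `x₀` of order prime to `p`; the others share one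
  -- order. Moreover `x₀` and `p • z` have equal order, hence are related.
  obtain ⟨x₀, hx₀, hx₀o⟩ : ∃ x₀, p • x₀ = p • z ∧ ¬ p ∣ addOrderOf x₀ := by
    have hc : p.Coprime (addOrderOf (p • z)) := (Nat.Prime.coprime_iff_not_dvd hp.out).2 hm
    obtain ⟨x₀, hx₀⟩ : p • z ∈ AddSubgroup.zmultiples (p • (p • z)) := by
      apply IsAddCyclic.mem_zmultiples_of_addOrderOf_nsmul
      rw [Nat.Coprime.addOrderOf_nsmul (Nat.coprime_comm.1 hc), addOrderOf_nsmul_eq_zero]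
    refine ⟨x₀ • (p • z), ?_, ?_⟩
    · rw [smul_comm p x₀]; exact hx₀
    · intro hd
      exact hm (hd.trans (addOrderOf_dvd_of_mem_zmultiples
        (AddSubgroup.zsmul_mem_zmultiples _ _)))
  have huniq : ∀ a, p • a = p • z → ¬ p ∣ addOrderOf a → a = x₀ := by
    intro a ha hao
    have e1 : p • (a - x₀) = 0 := by rw [smul_sub, ha, hx₀, sub_self]
    have e2 : addOrderOf (p • z) • (a - x₀) = 0 := by
      rw [smul_sub]
      nth_rw 1 [← ha, ← hdich' a hao]
      rw [addOrderOf_nsmul_eq_zero, ← hx₀, ← hdich' x₀ hx₀o, addOrderOf_nsmul_eq_zero, sub_self]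
    have e3 := Nat.dvd_gcd (addOrderOf_dvd_of_nsmul_eq_zero e1)
      (addOrderOf_dvd_of_nsmul_eq_zero e2)
    rw [(Nat.Prime.coprime_iff_not_dvd hp.out).2 hm, Nat.dvd_one, AddMonoid.addOrderOf_eq_one_iff]
      at e3
    exact sub_eq_zero.1 e3
  have hsame' : ∀ a b, p • a = p • z → p • b = p • z → a ≠ x₀ → b ≠ x₀ → (a ∈ O ↔ b ∈ O) := by
    intro a b ha hb ha' hb'
    apply hO.mem_iff
    apply h.rel_of_addOrderOf_eq
    rw [hdich a (by_contra fun hc => ha' (huniq a ha hc)),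
      hdich b (by_contra fun hc => hb' (huniq b hb hc)), ha, hb]
  have hx₀y : x₀ ∈ U ↔ p • z ∈ U := by
    apply hUs.mem_iff
    apply h.rel_of_addOrderOf_eq
    rw [hdich' x₀ hx₀o, hx₀]
  have hx₀y' : x₀ ∈ O ↔ p • z ∈ O := by
    apply hO.mem_iff
    apply h.rel_of_addOrderOf_eq
    rw [hdich' x₀ hx₀o, hx₀]
  -- the elements of the fibre other than `x₀`
  have hcard := card_filter_nsmul_eq_zero hpC z
  rw [← Finset.insert_erase (s := Finset.univ.filter fun a : C => p • a = p • z) (a := x₀)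
    (by simpa using hx₀), Finset.card_insert_of_notMem (by simp)] at hcard
  push_cast at hcard
  -- If `O` separates `x₀` from the rest of the fibre, the count is `1` or the fibre size minus `1`;
  -- both are non-zero modulo `p`.
  have hcount : ∀ b : C, p • b = p • z → b ≠ x₀ → (x₀ ∈ O ↔ b ∉ O) → p • z ∈ U := by
    intro b hb hbx hiff
    rw [hU, Set.mem_ofPred_eq]
    by_cases hxO : x₀ ∈ O
    · have : (Finset.univ.filter fun a => a ∈ O ∧ p • a = p • z) = {x₀} := by
        ext a
        simp only [Finset.mem_filter, Finset.mem_univ, true_and, Finset.mem_singleton]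
        constructor
        · rintro ⟨ha, ha'⟩
          by_contra hne
          exact hiff.1 hxO ((hsame' a b ha' hb hne hbx).1 ha)
        · rintro rfl
          exact ⟨hxO, hx₀⟩
      rw [this]
      simp
    · have : (Finset.univ.filter fun a => a ∈ O ∧ p • a = p • z) =
          (Finset.univ.filter fun a : C => p • a = p • z).erase x₀ := by
        ext a
        simp only [Finset.mem_filter, Finset.mem_univ, true_and, Finset.mem_erase]
        constructor
        · rintro ⟨ha, ha'⟩
          exact ⟨fun e => hxO (e ▸ ha), ha'⟩
        · rintro ⟨hne, ha'⟩
          exact ⟨(hsame' a b ha' hb hne hbx).2 (not_not.1 fun hc => hxO (hiff.2 hc)), ha'⟩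
      rw [this]
      intro h0
      rw [h0, zero_add] at hcard
      exact one_ne_zero hcard
  by_cases hxO : x₀ ∈ O
  · have hnU : p • z ∉ U := hOU _ (hx₀y'.1 hxO)
    by_contra hcon
    have hne : z' ≠ x₀ := fun e => hcon (Or.inl (e ▸ hxO))
    exact hnU (hcount z' hz.symm hne (iff_of_true hxO fun hc => hcon (Or.inl hc)))
  · rcases hzV with hzO | hzU
    · have hzx : z ≠ x₀ := fun e => hxO (e ▸ hzO)
      have hyU := hcount z rfl hzx (iff_of_false hxO fun hc => hc hzO)
      by_cases hne : z' = x₀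
      · exact Or.inr (hne ▸ hx₀y.2 hyU)
      · exact Or.inl ((hsame' z z' rfl hz.symm hzx hne).1 hzO)
    · have hzx := huniq z rfl (hUord z hzU)
      by_cases hne : z' = x₀
      · rw [hne, ← hzx]; exact Or.inr hzU
      · by_contra hcon
        refine hnone z (fun a ha haO => ?_) (hx₀y.1 (hzx ▸ hzU))
        have hax : a ≠ x₀ := fun e => hxO (e ▸ haO)
        exact hcon (Or.inl ((hsame' a z' ha hz.symm hax hne).1 haO))

/-- Write `y = k • g`. Then `k` is prime to the order of `g` modulo `S`, and can be changed modulo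
that order to be prime to the order of `g`. -/
theorem exists_mk_eq_and_zmultiples_eq {S : AddSubgroup C} {g y : C}
    
    (hy : y ∈ AddSubgroup.zmultiples g)
    (hg : (g : C ⧸ S) ∈ AddSubgroup.zmultiples (y : C ⧸ S)) :
    ∃ g' : C, (g' : C ⧸ S) = y ∧ AddSubgroup.zmultiples g' = AddSubgroup.zmultiples g := by
  obtain ⟨k, rfl⟩ := exists_nsmul_eq_of_mem_zmultiples hy
  have hd : addOrderOf (g : C ⧸ S) ∣ addOrderOf g :=
    addOrderOf_map_dvd (QuotientAddGroup.mk' S) g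
  have hk : k.Coprime (addOrderOf (g : C ⧸ S)) := by
    have h1 := addOrderOf_dvd_of_mem_zmultiples hg
    rw [QuotientAddGroup.mk_nsmul, addOrderOf_nsmul] at h1
    have h0 := addOrderOf_pos (g : C ⧸ S)
    have h2 := Nat.div_mul_cancel (Nat.gcd_dvd_left (addOrderOf (g : C ⧸ S)) k)
    have h3 := Nat.le_of_dvd (Nat.div_pos (Nat.gcd_le_left _ h0) (Nat.gcd_pos_of_pos_left _ h0)) h1
    rw [Nat.coprime_comm]
    have h4 : 0 < (addOrderOf (g : C ⧸ S)).gcd k := Nat.gcd_pos_of_pos_left _ h0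
    by_contra hne
    have : 2 ≤ (addOrderOf (g : C ⧸ S)).gcd k := by
      rw [Nat.Coprime] at hne; omega
    nlinarith
  obtain ⟨k', h1, h2⟩ := Nat.exists_modEq_coprime (addOrderOf_pos g).ne' hd hk
  refine ⟨k' • g, ?_, ?_⟩
  · exact nsmul_eq_nsmul_iff_modEq.2 h1
  · refine AddSubgroup.eq_of_le_of_card_ge ?_ ?_
    · rw [AddSubgroup.zmultiples_le]
      exact AddSubgroup.nsmul_mem_zmultiples g k'
    · rw [Nat.card_zmultiples, Nat.card_zmultiples,
        Nat.Coprime.addOrderOf_nsmul (Nat.coprime_comm.1 h2)]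

/-- The subgroup of the translations that preserve `V`. -/
def translationStabilizer (V : Set C) : AddSubgroup C where
  carrier := {s | ∀ v, v ∈ V ↔ v + s ∈ V}
  zero_mem' := by simp
  add_mem' {a b} ha hb v := by rw [ha v, hb (v + a), add_assoc]
  neg_mem' {a} ha v := by rw [ha (v + -a), neg_add_cancel_right]

open Pointwise in
-- A translation fails to preserve `V` exactly when it is a difference between a point of `V` and a
-- point outside, in either order; such differences form sumsets.
theorem isSaturated_translationStabilizer (h : IsRationalSchurRing R) {V : Set C}
    (hV : R.IsSaturated V) : R.IsSaturated (translationStabilizer V : Set C) := by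
  have : (translationStabilizer V : Set C) = ((Vᶜ + -V) ∪ (V + -Vᶜ))ᶜ := by
    ext s
    change (∀ v, v ∈ V ↔ v + s ∈ V) ↔ _
    simp only [Set.mem_compl_iff, Set.mem_union, Set.mem_add, Set.mem_neg, not_or, not_exists,
      not_and]
    constructor
    · intro hs
      constructor
      · rintro a ha b hb rfl
        exact ha (by simpa using (hs (-b)).1 hb)
      · rintro a ha b hb rfl
        exact hb ((hs (-b)).2 (by simpa using ha))
    · rintro ⟨h1, h2⟩ v
      constructor
      · intro hv
        by_contra hc
        exact h1 _ hc (-v) (by simpa using hv) (by simp)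
      · intro hv
        by_contra hc
        exact h2 _ hv (-v) (by simpa using hc) (by simp)
  rw [this]
  exact ((h.isSaturated_add hV.compl (h.isSaturated_neg hV)).union
    (h.isSaturated_add hV (h.isSaturated_neg hV.compl))).compl

/-! ### Generators inside the classes -/

/-- Every class of a rational Schur ring over a cyclic group contains a generator of the subgroup
that it generates. -/
theorem exists_rel_forall_mem_zmultiples : ∀ (N : ℕ) (C : Type u) [AddCommGroup C] [Fintype C]
    [IsAddCyclic C] (R : Setoid C), Nat.card C = N → IsRationalSchurRing R → ∀ x : C,
    ∃ y, R x y ∧ ∀ z, R x z → z ∈ AddSubgroup.zmultiples y := by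
  classical
  intro N
  induction N using Nat.strong_induction_on with | _ N ih => ?_
  intro C _ _ _ R hN h x
  by_cases hx : x = 0
  · subst hx
    refine ⟨0, R.refl' 0, fun z hz => ?_⟩
    rw [h.eq_zero z hz]
    exact zero_mem _
  set O : Set C := {y | R x y} with hO
  have hOs : R.IsSaturated O := Setoid.IsSaturated.setOf_rel x
  obtain ⟨g, hg⟩ : ∃ g : C, AddSubgroup.closure O = AddSubgroup.zmultiples g := by
    obtain ⟨g, hg⟩ := IsAddCyclic.exists_generator (α := AddSubgroup.closure O)
    refine ⟨g, le_antisymm (fun a ha => ?_) ?_⟩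
    · obtain ⟨k, hk⟩ := hg ⟨a, ha⟩
      exact ⟨k, congrArg Subtype.val hk⟩
    · rw [AddSubgroup.zmultiples_le]
      exact g.2
  have hOg : ∀ z ∈ O, z ∈ AddSubgroup.zmultiples g := fun z hz =>
    hg ▸ AddSubgroup.subset_closure hz
  have hxO : x ∈ O := R.refl' x
  have hg1 : addOrderOf g ≠ 1 := by
    rw [ne_eq, AddMonoid.addOrderOf_eq_one_iff]
    rintro rfl
    exact hx (by simpa using hOg x hxO)
  obtain ⟨p, hp, hpg⟩ := Nat.exists_prime_and_dvd hg1
  have : Fact p.Prime := ⟨hp⟩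
  have hpC : p ∣ Nat.card C := hpg.trans (addOrderOf_dvd_natCard g)
  have hgp : g ∉ AddSubgroup.zmultiples (p • g) := by
    intro hc
    have h1 := addOrderOf_dvd_of_mem_zmultiples hc
    rw [addOrderOf_nsmul' g hp.ne_zero, Nat.gcd_eq_right hpg] at h1
    have h0 := addOrderOf_pos g
    have h2 := Nat.le_of_dvd (Nat.div_pos (Nat.le_of_dvd h0 hpg) hp.pos) h1
    exact absurd (Nat.div_lt_self h0 hp.one_lt) (not_lt.2 h2)
  -- `U` is the support modulo `p` of the `p`-th convolution power of `O`. It lies in the proper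
  -- subgroup generated by `p • g`.
  obtain ⟨U, hU⟩ : ∃ U : Set C,
      U = {y | ((Finset.univ.filter fun a => a ∈ O ∧ p • a = y).card : ZMod p) ≠ 0} := ⟨_, rfl⟩
  have hUs : R.IsSaturated U := by
    intro x y hxy hx
    rw [hU, Set.mem_ofPred_eq] at hx ⊢
    rwa [← h.card_filter_nsmul_eq hOs hxy]
  have hUg : ∀ u ∈ U, u ∈ AddSubgroup.zmultiples (p • g) := by
    intro u hu
    rw [hU, Set.mem_ofPred_eq] at hu
    have : (Finset.univ.filter fun a => a ∈ O ∧ p • a = u).Nonempty := by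
      rw [← Finset.card_pos, Nat.pos_iff_ne_zero]
      intro h0
      exact hu (by rw [h0, Nat.cast_zero])
    obtain ⟨a, ha⟩ := this
    simp only [Finset.mem_filter, Finset.mem_univ, true_and] at ha
    obtain ⟨k, hk⟩ := hOg a ha.1
    exact ⟨k, by rw [← ha.2, ← hk]; exact smul_comm _ _ _⟩
  have hOU : ∀ z ∈ O, z ∉ U := by
    intro z hz hzU
    have h1 : O ⊆ AddSubgroup.zmultiples (p • g) := fun w hw =>
      hUg w (hUs z w (R.trans' (R.symm' hz) hw) hzU)
    rw [← AddSubgroup.closure_le, hg] at h1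
    exact hgp (h1 (AddSubgroup.mem_zmultiples g))
  -- `S` contains the `p`-torsion, so it is non-trivial and induction applies to `C ⧸ S`.
  set S := translationStabilizer (O ∪ U) with hS
  have hSs : R.IsSaturated (S : Set C) := h.isSaturated_translationStabilizer (hOs.union hUs)
  have hpS : ∀ t : C, p • t = 0 → t ∈ S := fun t ht v =>
    ⟨h.mem_union_of_nsmul_eq hpC hOs hU hOU (by rw [smul_add, ht, add_zero]),
      h.mem_union_of_nsmul_eq hpC hOs hU hOU (by rw [smul_add, ht, add_zero])⟩
  have hSbot : S ≠ ⊥ := by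
    obtain ⟨t, ht⟩ := exists_prime_addOrderOf_dvd_card' p hpC
    intro hbot
    have : t ∈ S := hpS t (by rw [← ht, addOrderOf_nsmul_eq_zero])
    rw [hbot, AddSubgroup.mem_bot] at this
    rw [this, addOrderOf_zero] at ht
    exact hp.one_lt.ne ht
  have hcard : Nat.card (C ⧸ S) < N := by
    rw [← hN, AddSubgroup.card_eq_card_quotient_mul_card_addSubgroup S]
    exact lt_mul_of_one_lt_right Nat.card_pos ((AddSubgroup.one_lt_card_iff_ne_bot S).2 hSbot)
  have : IsAddCyclic (C ⧸ S) := isAddCyclic_of_surjective (QuotientAddGroup.mk' S)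
    (QuotientAddGroup.mk'_surjective S)
  obtain ⟨c, hc1, hc2⟩ := ih _ hcard (C ⧸ S) (R.quotientAddSubgroup S) rfl (h.quotient hSs) x
  -- The image of `O` is a union of quotient classes, because `O + S` is saturated; so it contains
  -- `c`.
  obtain ⟨y, hyO, rfl⟩ : ∃ y ∈ O, (y : C ⧸ S) = c := by
    have := hc1 (fun c => if ∃ y ∈ O, (y : C ⧸ S) = c then 1 else 0) (fun a b hab => by
      have key : ∀ a : C, (∃ y ∈ O, (y : C ⧸ S) = a) ↔ a ∈ {a | ∃ y ∈ O, ∃ s ∈ S, y + s = a} := by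
        intro a
        refine exists_congr fun y => and_congr_right fun _ => ?_
        rw [QuotientAddGroup.eq]
        exact ⟨fun h => ⟨_, h, by simp⟩, by rintro ⟨s, hs, rfl⟩; simpa using hs⟩
      have hsat : R.IsSaturated {a | ∃ y ∈ O, ∃ s ∈ S, y + s = a} := h.isSaturated_add hOs hSs
      simp only [key, hsat.mem_iff hab])
    by_contra hcon
    rw [if_pos ⟨x, hxO, rfl⟩, if_neg hcon] at this
    exact one_ne_zero this
  have hgy : (g : C ⧸ S) ∈ AddSubgroup.zmultiples (y : C ⧸ S) := by
    have h1 : O ⊆ (AddSubgroup.zmultiples (y : C ⧸ S)).comap (QuotientAddGroup.mk' S) :=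
      fun z hz => hc2 z fun f hf => hf x z hz
    rw [← AddSubgroup.closure_le, hg] at h1
    exact h1 (AddSubgroup.mem_zmultiples g)
  -- Lift `y` modulo `S` to a generator `g'` of the subgroup generated by `O`. It stays in `O ∪ U`,
  -- and `U` contains no such generator.
  obtain ⟨g', hg'y, hg'⟩ := exists_mk_eq_and_zmultiples_eq (hOg y hyO) hgy
  have hg'V : g' ∈ O ∪ U := by
    rw [eq_comm, QuotientAddGroup.eq] at hg'y
    have := (hg'y y).1 (Or.inl hyO)
    simpa using this
  rcases hg'V with hO' | hU'
  · exact ⟨g', hO', fun z hz => hg' ▸ hOg z hz⟩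
  · exfalso
    have : AddSubgroup.zmultiples g' ≤ AddSubgroup.zmultiples (p • g) := by
      rw [AddSubgroup.zmultiples_le]
      exact hUg g' hU'
    rw [hg'] at this
    exact hgp (this (AddSubgroup.mem_zmultiples g))

end IsRationalSchurRing

/-- `ζ` and `ζ ^ u` are primitive roots of the same order, so they share a cyclotomic minimal
polynomial. -/
theorem Polynomial.aeval_pow_eq_zero_of_coprime {n : ℕ} (hn : 0 < n) {ζ : ℂ} (hζ : ζ ^ n = 1)
    (E : ℚ[X]) (hE : aeval ζ E = 0) {u : ℕ} (hu : u.Coprime n) : aeval (ζ ^ u) E = 0 := by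
  have hm : 0 < orderOf ζ := orderOf_pos_iff.2 (isOfFinOrder_iff_pow_eq_one.2 ⟨n, hn, hζ⟩)
  have h1 : IsPrimitiveRoot ζ (orderOf ζ) := IsPrimitiveRoot.orderOf ζ
  have h2 := h1.pow_of_coprime u (hu.coprime_dvd_right (orderOf_dvd_of_pow_eq_one hζ))
  have h3 : minpoly ℚ ζ = minpoly ℚ (ζ ^ u) := by
    rw [← cyclotomic_eq_minpoly_rat h1 hm, ← cyclotomic_eq_minpoly_rat h2 hm]
  obtain ⟨F, hF⟩ := minpoly.dvd ℚ ζ hE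
  rw [hF, h3, map_mul, minpoly.aeval, zero_mul]

/-! ### The Schur ring of frequencies of a permutation group -/

namespace ZMod

variable {n : ℕ} [NeZero n]

theorem sum_stdAddChar_mul (a : ZMod n) :
    ∑ t : ZMod n, stdAddChar (t * a) = if a = 0 then (n : ℂ) else 0 := by
  have := AddChar.sum_mulShift a (isPrimitive_stdAddChar n)
  simpa [ZMod.card] using this

theorem stdAddChar_eq_one_iff (a : ZMod n) : stdAddChar a = 1 ↔ a = 0 := by
  rw [← AddChar.map_zero_eq_one (stdAddChar (N := n)), injective_stdAddChar.eq_iff]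

theorem conj_stdAddChar (a : ZMod n) :
    starRingEnd ℂ (stdAddChar a) = stdAddChar (-a) := by
  rw [AddChar.map_neg_eq_conj]

/-- The entries, up to the factor `n`, of the permutation operator of `g` in the Fourier basis. -/
noncomputable def permCoeff (g : Equiv.Perm (ZMod n)) (r s : ZMod n) : ℂ :=
  ∑ j, stdAddChar (r * g j - s * j)

theorem permCoeff_inv (g : Equiv.Perm (ZMod n)) (r s : ZMod n) :
    permCoeff g⁻¹ s r = starRingEnd ℂ (permCoeff g r s) := by
  rw [permCoeff, permCoeff, map_sum, ← Equiv.sum_comp g]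
  refine Finset.sum_congr rfl fun j _ => ?_
  rw [conj_stdAddChar, neg_sub, Equiv.Perm.inv_def, Equiv.symm_apply_apply]

/-- Composition with `g` respects the product of the characters `r` and `r'`, and Fourier
coefficients of a product are a convolution; the missing normalisation yields `n`. -/
theorem sum_permCoeff_mul_right (g : Equiv.Perm (ZMod n)) (r r' s : ZMod n) :
    ∑ t, permCoeff g r t * permCoeff g r' (s - t) = n * permCoeff g (r + r') s := by
  simp only [permCoeff, Finset.sum_mul_sum]
  rw [Finset.sum_comm]
  rw [Finset.mul_sum]
  refine Finset.sum_congr rfl fun j _ => ?_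
  rw [Finset.sum_comm]
  have : ∀ k, ∑ t, stdAddChar (r * g j - t * j) * stdAddChar (r' * g k - (s - t) * k) =
      if k = j then (n : ℂ) * stdAddChar ((r + r') * g j - s * j) else 0 := by
    intro k
    have e : ∀ t : ZMod n, stdAddChar (r * g j - t * j) * stdAddChar (r' * g k - (s - t) * k) =
        stdAddChar (r * g j + r' * g k - s * k) * stdAddChar (t * (k - j)) := by
      intro t
      rw [← AddChar.map_add_eq_mul, ← AddChar.map_add_eq_mul]
      congr 1
      ring
    simp only [e]
    rw [← Finset.mul_sum, sum_stdAddChar_mul]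
    simp only [sub_eq_zero]
    split_ifs with hk
    · rw [hk, mul_comm]
      congr 2
      ring
    · rw [mul_zero]
  simp only [this]
  simp

theorem sum_permCoeff_mul_left (g : Equiv.Perm (ZMod n)) (r s s' : ZMod n) :
    ∑ a, permCoeff g a s * permCoeff g (r - a) s' = n * permCoeff g r (s + s') := by
  have := congrArg (starRingEnd ℂ) (sum_permCoeff_mul_right g⁻¹ s s' r)
  rw [map_sum, map_mul, map_natCast] at this
  simp only [map_mul, ← permCoeff_inv, inv_inv] at this
  exact this

variable (G : Subgroup (Equiv.Perm (ZMod n)))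

/-- The functions of the frequency that are invariant under units and act as Fourier multipliers
that commute with `G`. -/
def IsInvariantMultiplier (f : ZMod n → ℤ) : Prop :=
  (∀ g ∈ G, ∀ r s, permCoeff g r s ≠ 0 → f r = f s) ∧ ∀ (u : (ZMod n)ˣ) (r), f (u * r) = f r

/-- The partition of the set of frequencies that is defined by the invariant multipliers. -/
def spectralSetoid : Setoid (ZMod n) where
  r a b := ∀ f, IsInvariantMultiplier G f → f a = f b
  iseqv := ⟨fun _ _ _ => rfl, fun h f hf => (h f hf).symm, fun h h' f hf => (h f hf).trans (h' f hf)⟩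

variable {G}

theorem spectralSetoid_rel {a b : ZMod n} :
    spectralSetoid G a b ↔ ∀ f, IsInvariantMultiplier G f → f a = f b := Iff.rfl

theorem spectralSetoid_of_permCoeff_ne_zero {g} (hg : g ∈ G) {r s : ZMod n}
    (h : permCoeff g r s ≠ 0) : spectralSetoid G r s :=
  spectralSetoid_rel.2 fun _ hf => hf.1 g hg r s h

theorem spectralSetoid_unit_mul (u : (ZMod n)ˣ) (r : ZMod n) : spectralSetoid G r (u * r) :=
  spectralSetoid_rel.2 fun _ hf => (hf.2 u r).symm

theorem isSaturated_spectralSetoid {X : Set (ZMod n)}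
    (h : ∀ g ∈ G, ∀ r s, permCoeff g r s ≠ 0 → r ∈ X → s ∈ X)
    (h' : ∀ (u : (ZMod n)ˣ) (r), r ∈ X → u * r ∈ X) : (spectralSetoid G).IsSaturated X := by
  classical
  intro x y hxy hx
  have := spectralSetoid_rel.1 hxy (fun a => if a ∈ X then 1 else 0) ⟨?_, ?_⟩
  · by_contra hy
    rw [if_pos hx, if_neg hy] at this
    exact one_ne_zero this
  · intro g hg r s hrs
    have : r ∈ X ↔ s ∈ X := by
      refine ⟨h g hg r s hrs, h g⁻¹ (inv_mem hg) s r ?_⟩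
      rw [permCoeff_inv]
      simpa using hrs
    simp only [this]
  · intro u r
    have : u * r ∈ X ↔ r ∈ X :=
      ⟨fun hr => by simpa using h' u⁻¹ _ hr, h' u r⟩
    simp only [this]

/-- Expand `n * permCoeff h r s` by one product identity, move the multipliers from `a`, `r - a` to
`t`, `s - t` by commutation with `h`, and contract by the other identity. -/
theorem IsInvariantMultiplier.conv {f g : ZMod n → ℤ} (hf : IsInvariantMultiplier G f)
    (hg : IsInvariantMultiplier G g) :
    IsInvariantMultiplier G fun r => ∑ a, f a * g (r - a) := by
  constructor
  · intro h hh r s hrs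
    have e1 : ∀ {f : ZMod n → ℤ}, IsInvariantMultiplier G f → ∀ a b,
        (f a : ℂ) * permCoeff h a b = f b * permCoeff h a b := by
      intro f hf a b
      by_cases hab : permCoeff h a b = 0
      · rw [hab, mul_zero, mul_zero]
      · rw [hf.1 h hh a b hab]
    have hn : (n : ℂ) ≠ 0 := Nat.cast_ne_zero.2 (NeZero.ne n)
    have key : ((∑ a, f a * g (r - a) : ℤ) : ℂ) * (n * permCoeff h r s) =
        ((∑ a, f a * g (s - a) : ℤ) : ℂ) * (n * permCoeff h r s) := by
      push_cast
      rw [Finset.sum_mul, Finset.sum_mul]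
      calc ∑ a, (f a : ℂ) * g (r - a) * (n * permCoeff h r s)
          = ∑ a, ∑ t, ((f a : ℂ) * permCoeff h a t) * (g (r - a) * permCoeff h (r - a) (s - t)) := by
            refine Finset.sum_congr rfl fun a _ => ?_
            have := sum_permCoeff_mul_right h a (r - a) s
            rw [add_sub_cancel] at this
            rw [← this, Finset.mul_sum]
            exact Finset.sum_congr rfl fun t _ => by ring
        _ = ∑ t, ∑ a, ((f t : ℂ) * g (s - t)) * (permCoeff h a t * permCoeff h (r - a) (s - t)) := by
            rw [Finset.sum_comm]
            refine Finset.sum_congr rfl fun t _ => Finset.sum_congr rfl fun a _ => ?_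
            rw [e1 hf, e1 hg]
            ring
        _ = ∑ t, (f t : ℂ) * g (s - t) * (n * permCoeff h r s) := by
            refine Finset.sum_congr rfl fun t _ => ?_
            have := sum_permCoeff_mul_left h r t (s - t)
            rw [add_sub_cancel] at this
            rw [← this, Finset.mul_sum]
    exact_mod_cast mul_right_cancel₀ (mul_ne_zero hn hrs) key
  · intro u r
    refine (Equiv.sum_comp (Units.mulLeft u) _).symm.trans ?_
    refine Finset.sum_congr rfl fun a _ => ?_
    rw [Units.mulLeft_apply, ← mul_sub, hf.2, hg.2]

theorem isRationalSchurRing_spectralSetoid : IsRationalSchurRing (spectralSetoid G) where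
  eq_zero x hx := by
    have : (spectralSetoid G).IsSaturated {0} := by
      apply isSaturated_spectralSetoid
      -- Permutations fix constants, so frequency `0` is connected to no other.
      · rintro g - r s hrs rfl
        by_contra hs
        refine hrs ?_
        have := sum_stdAddChar_mul (-s)
        rw [if_neg (by simpa using hs)] at this
        rw [← this]
        exact Finset.sum_congr rfl fun j _ => by congr 1; ring
      · rintro u r rfl
        simp
    exact this 0 x hx rfl
  nsmul x k hk := by
    rw [Nat.card_zmod] at hk
    have := spectralSetoid_unit_mul (G := G) (unitOfCoprime k hk) x
    rwa [coe_unitOfCoprime, ← nsmul_eq_mul] at this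
  conv f g hf hg x y hxy := by
    have key : ∀ f : ZMod n → ℤ, (∀ x y, spectralSetoid G x y → f x = f y) →
        IsInvariantMultiplier G f := fun f hf =>
      ⟨fun g hg r s hrs => hf r s (spectralSetoid_of_permCoeff_ne_zero hg hrs),
        fun u r => (hf _ _ (spectralSetoid_unit_mul u r)).symm⟩
    exact spectralSetoid_rel.1 hxy _ ((key f hf).conv (key g hg))

theorem exists_eq_natCast_mul {d e : ℕ} (hde : d * e = n) {r : ZMod n} (hr : (d : ZMod n) * r = 0) :
    ∃ c, r = e * c := by
  have hd : 0 < d := Nat.pos_of_ne_zero fun h => NeZero.ne n (by rw [← hde, h, zero_mul])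
  rw [← natCast_zmod_val r, ← Nat.cast_mul, natCast_eq_zero_iff] at hr
  obtain ⟨c, hc⟩ := hr
  refine ⟨c, ?_⟩
  rw [← natCast_zmod_val r, ← Nat.cast_mul]
  congr 1
  apply Nat.eq_of_mul_eq_mul_left hd
  rw [hc, ← hde, mul_assoc]

theorem natCast_mul_natCast_of_mul_eq {m d e : ℕ} (hde : d * e = m) :
    (d : ZMod m) * (e : ZMod m) = 0 := by
  rw [← Nat.cast_mul, hde, natCast_self]

/-- The annihilator of `d` consists of the multiples of `e`, the frequencies of `d`-periodic
functions; saturation means that `G` preserves `d`-periodicity. -/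
theorem isSaturated_annihilator_iff {d e : ℕ} (hde : d * e = n) :
    (spectralSetoid G).IsSaturated {r | (d : ZMod n) * r = 0} ↔
      ∀ g ∈ G, ∀ i j : ZMod n, (e : ZMod n) * (i - j) = 0 → (e : ZMod n) * (g i - g j) = 0 := by
  constructor
  · intro h g hg i j hij
    -- Fourier inversion for the character of frequency `e` composed with `g`; it separates the
    -- residues modulo `d`.
    have inv : ∀ i, (n : ℂ) * stdAddChar ((e : ZMod n) * g i) =
        ∑ s, permCoeff g e s * stdAddChar (s * i) := by
      intro i
      simp only [permCoeff, Finset.sum_mul]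
      rw [Finset.sum_comm]
      have : ∀ j, ∑ s, stdAddChar ((e : ZMod n) * g j - s * j) * stdAddChar (s * i) =
          if i = j then (n : ℂ) * stdAddChar ((e : ZMod n) * g i) else 0 := by
        intro j
        have e1 : ∀ s : ZMod n, stdAddChar ((e : ZMod n) * g j - s * j) * stdAddChar (s * i) =
            stdAddChar ((e : ZMod n) * g j) * stdAddChar (s * (i - j)) := by
          intro s
          rw [← AddChar.map_add_eq_mul, ← AddChar.map_add_eq_mul]
          congr 1
          ring
        simp only [e1]
        rw [← Finset.mul_sum, sum_stdAddChar_mul]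
        simp only [sub_eq_zero]
        split_ifs with hij
        · rw [hij, mul_comm]
        · rw [mul_zero]
      simp only [this]
      simp
    have hn : (n : ℂ) ≠ 0 := Nat.cast_ne_zero.2 (NeZero.ne n)
    have key : stdAddChar ((e : ZMod n) * g i) = stdAddChar ((e : ZMod n) * g j) := by
      apply mul_left_cancel₀ hn
      rw [inv, inv]
      refine Finset.sum_congr rfl fun s _ => ?_
      by_cases hs : permCoeff g e s = 0
      · rw [hs, zero_mul, zero_mul]
      · have hds : (d : ZMod n) * s = 0 := h e s (spectralSetoid_of_permCoeff_ne_zero hg hs)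
          (natCast_mul_natCast_of_mul_eq hde)
        obtain ⟨c, rfl⟩ := exists_eq_natCast_mul hde hds
        have : (e : ZMod n) * c * i = e * c * j := by
          linear_combination c * hij
        rw [this]
    rw [mul_sub, sub_eq_zero]
    exact injective_stdAddChar key
  · intro h
    apply isSaturated_spectralSetoid
    · intro g hg r s hrs hr
      obtain ⟨c, rfl⟩ := exists_eq_natCast_mul hde hr
      -- The substitution `j ↦ j + d` multiplies the coefficient by this character value, so a
      -- non-zero coefficient forces `d * s = 0`.
      have key : stdAddChar (-((d : ZMod n) * s)) * permCoeff g (e * c) s = permCoeff g (e * c) s := by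
        conv_rhs => rw [permCoeff, ← Equiv.sum_comp (Equiv.addRight (d : ZMod n))]
        rw [permCoeff, Finset.mul_sum]
        refine Finset.sum_congr rfl fun j _ => ?_
        rw [← AddChar.map_add_eq_mul, Equiv.coe_addRight]
        congr 1
        have := h g hg (j + d) j (by
          rw [add_sub_cancel_left, mul_comm]
          exact natCast_mul_natCast_of_mul_eq hde)
        linear_combination -c * this
      have := mul_right_cancel₀ hrs (key.trans (one_mul _).symm)
      rw [stdAddChar_eq_one_iff, neg_eq_zero] at this
      exact this
    · intro u r hr
      change (d : ZMod n) * (u * r) = 0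
      rw [mul_left_comm, show (d : ZMod n) * r = 0 from hr, mul_zero]

/-- The Fourier coefficients of `δ ∘ h`. -/
noncomputable def fourierCoeffComp (δ : ZMod n → ℚ) (h : Equiv.Perm (ZMod n)) (r : ZMod n) : ℂ :=
  ∑ j, (δ (h j) : ℂ) * stdAddChar (-(r * j))

theorem addRight_mem (hG : Equiv.addRight (1 : ZMod n) ∈ G) (c : ZMod n) :
    Equiv.addRight c ∈ G := by
  have hpow : ∀ k : ℕ, Equiv.addRight (k : ZMod n) = Equiv.addRight (1 : ZMod n) ^ k := by
    intro k
    induction k with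
    | zero => ext; simp
    | succ k ih => rw [pow_succ, ← ih]; ext; simp [add_assoc, add_comm (1 : ZMod n)]
  rw [← natCast_zmod_val c, hpow]
  exact pow_mem hG _

/-- Averaging the translates by `h * Equiv.addRight c * g⁻¹` over `c` relates the frequencies `r`
and `s`. Stability under units is Galois conjugation, as `δ` is rational. -/
theorem isSaturated_fourierCoeffComp_eq_zero (hG : Equiv.addRight (1 : ZMod n) ∈ G)
    (δ : ZMod n → ℚ) :
    (spectralSetoid G).IsSaturated {r | ∀ h ∈ G, fourierCoeffComp δ h r = 0} := by
  apply isSaturated_spectralSetoid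
  · intro g hg r s hrs hr h hh
    have key : ∑ c, stdAddChar (-(s * c)) *
        fourierCoeffComp δ (h * Equiv.addRight c * g⁻¹) r =
        fourierCoeffComp δ h s * starRingEnd ℂ (permCoeff g r s) := by
      have e1 : ∀ c, fourierCoeffComp δ (h * Equiv.addRight c * g⁻¹) r =
          ∑ k, (δ (h (k + c)) : ℂ) * stdAddChar (-(r * g k)) := by
        intro c
        rw [fourierCoeffComp, ← Equiv.sum_comp g]
        simp
      simp only [e1, Finset.mul_sum]
      rw [Finset.sum_comm, permCoeff, map_sum, Finset.mul_sum]
      refine Finset.sum_congr rfl fun k _ => ?_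
      rw [fourierCoeffComp, Finset.sum_mul]
      rw [← Equiv.sum_comp (Equiv.addLeft k) (fun j => (δ (h j) : ℂ) * stdAddChar (-(s * j)) *
        starRingEnd ℂ (stdAddChar (r * g k - s * k)))]
      refine Finset.sum_congr rfl fun c _ => ?_
      simp only [Equiv.coe_addLeft]
      rw [conj_stdAddChar, mul_assoc, ← AddChar.map_add_eq_mul, mul_left_comm,
        ← AddChar.map_add_eq_mul]
      congr 2
      ring
    rw [Finset.sum_eq_zero fun c _ => by
      rw [hr _ (mul_mem (mul_mem hh (addRight_mem hG c)) (inv_mem hg)), mul_zero]] at key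
    refine (mul_eq_zero.1 key.symm).resolve_right ?_
    simpa using hrs
  · intro u r hr h hh
    have e1 : ∀ r, fourierCoeffComp δ h r =
        aeval (stdAddChar (-r)) (∑ j, C (δ (h j)) * X ^ j.val : ℚ[X]) := by
      intro r
      rw [map_sum, fourierCoeffComp]
      refine Finset.sum_congr rfl fun j _ => ?_
      rw [map_mul, aeval_C, map_pow, aeval_X, ← AddChar.map_nsmul_eq_pow, nsmul_eq_mul,
        natCast_zmod_val]
      congr 2
      ring
    have h1 := hr h hh
    rw [e1] at h1 ⊢
    have := aeval_pow_eq_zero_of_coprime (NeZero.pos n) (by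
      rw [← AddChar.map_nsmul_eq_pow, nsmul_eq_mul, natCast_self, zero_mul,
        AddChar.map_zero_eq_one]) _ h1 (val_coe_unit_coprime u)
    rw [← AddChar.map_nsmul_eq_pow, nsmul_eq_mul, natCast_zmod_val] at this
    rwa [← mul_neg]

/-- Averaging the relations over shifts gives a product of Fourier coefficients of `δ ∘ h` and `q`.
So `q` has only frequency `0`, and inversion makes it constant. -/
theorem eq_of_forall_sum_eq_zero (hG : Equiv.addRight (1 : ZMod n) ∈ G) {δ : ZMod n → ℚ}
    (hδ : ∀ r ≠ 0, ∃ h ∈ G, fourierCoeffComp δ h r ≠ 0) {q : ZMod n → ℂ}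
    (hq : ∀ h ∈ G, ∑ i, (δ (h i) : ℂ) * q i = 0) (i j : ZMod n) : q i = q j := by
  have h1 : ∀ r ≠ 0, ∑ i, q i * stdAddChar (r * i) = 0 := by
    intro r hr
    obtain ⟨h, hh, hne⟩ := hδ r hr
    have key : ∑ c, stdAddChar (-(r * c)) *
        (∑ i, (δ ((h * Equiv.addRight c) i) : ℂ) * q i) =
        fourierCoeffComp δ h r * ∑ i, q i * stdAddChar (r * i) := by
      simp only [Finset.mul_sum]
      rw [Finset.sum_comm]
      refine Finset.sum_congr rfl fun i _ => ?_
      rw [fourierCoeffComp, Finset.sum_mul]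
      rw [← Equiv.sum_comp (Equiv.addLeft i)
        (fun j => (δ (h j) : ℂ) * stdAddChar (-(r * j)) * (q i * stdAddChar (r * i)))]
      refine Finset.sum_congr rfl fun c _ => ?_
      have : stdAddChar (-(r * c)) = stdAddChar (-(r * (i + c))) * stdAddChar (r * i) := by
        rw [← AddChar.map_add_eq_mul]
        congr 1
        ring
      simp only [this, Equiv.coe_addLeft, Equiv.Perm.mul_apply, Equiv.coe_addRight]
      ring
    rw [Finset.sum_eq_zero fun c _ => by
      rw [hq _ (mul_mem hh (addRight_mem hG c)), mul_zero]] at key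
    exact (mul_eq_zero.1 key.symm).resolve_left hne
  have h2 : ∀ j, (n : ℂ) * q j = ∑ i, q i := by
    intro j
    have : ∑ r, (∑ i, q i * stdAddChar (r * i)) * stdAddChar (-(r * j)) = (n : ℂ) * q j := by
      simp only [Finset.sum_mul]
      rw [Finset.sum_comm]
      have : ∀ i, ∑ r, q i * stdAddChar (r * i) * stdAddChar (-(r * j)) =
          if i = j then (n : ℂ) * q j else 0 := by
        intro i
        have e1 : ∀ r : ZMod n, q i * stdAddChar (r * i) * stdAddChar (-(r * j)) =
            q i * stdAddChar (r * (i - j)) := by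
          intro r
          rw [mul_assoc, ← AddChar.map_add_eq_mul]
          congr 2
          ring
        simp only [e1]
        rw [← Finset.mul_sum, sum_stdAddChar_mul]
        simp only [sub_eq_zero]
        split_ifs with hij
        · rw [hij, mul_comm]
        · rw [mul_zero]
      simp only [this]
      simp
    rw [← this, Finset.sum_eq_single 0]
    · simp
    · intro r _ hr
      rw [h1 r hr, zero_mul]
    · simp
  exact mul_left_cancel₀ (Nat.cast_ne_zero.2 (NeZero.ne n)) ((h2 i).trans (h2 j).symm)

/-! ### Classes of frequencies and the divisors in `D(G)` -/

section Divisors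
open AbelianIntegral

/-- The class of `r` generates a subgroup whose order lies in `D` and divides `d`. Were it smaller,
a maximal proper divisor of `d` in `D` above it would be covered by `d` and annihilate `r`. -/
theorem exists_addOrderOf_eq {D : Set ℕ}
    (hD : ∀ d, d ∈ D ↔ d ∣ n ∧ (spectralSetoid G).IsSaturated {r | (d : ZMod n) * r = 0})
    {d : ℕ} (hd : d ∈ D) {r : ZMod n} (hr : (d : ZMod n) * r = 0)
    (hcov : ∀ d', DivisorCovers D d d' → (d' : ZMod n) * r ≠ 0) :
    ∃ y, spectralSetoid G r y ∧ addOrderOf y = d := by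
  classical
  have hS := isRationalSchurRing_spectralSetoid (G := G)
  obtain ⟨y, hry, hy⟩ := IsRationalSchurRing.exists_rel_forall_mem_zmultiples _ (ZMod n)
    (spectralSetoid G) rfl hS r
  refine ⟨y, hry, ?_⟩
  have hann : ∀ z : ZMod n, z ∈ AddSubgroup.zmultiples y ↔ (addOrderOf y : ZMod n) * z = 0 := by
    intro z
    rw [← nsmul_eq_mul]
    refine ⟨fun hz => ?_, IsAddCyclic.mem_zmultiples_of_addOrderOf_nsmul⟩
    obtain ⟨k, rfl⟩ := hz
    change addOrderOf y • k • y = 0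
    rw [smul_comm, addOrderOf_nsmul_eq_zero, smul_zero]
  have hyD : addOrderOf y ∈ D := by
    rw [hD]
    refine ⟨?_, ?_⟩
    · simpa using addOrderOf_dvd_natCard y
    · have h1 : AddSubgroup.closure {z | spectralSetoid G r z} = AddSubgroup.zmultiples y :=
        le_antisymm ((AddSubgroup.closure_le _).2 hy)
          ((AddSubgroup.zmultiples_le).2 (AddSubgroup.subset_closure hry))
      have h2 := hS.isSaturated_closure (Setoid.IsSaturated.setOf_rel r)
      rw [h1] at h2
      intro a b hab ha
      exact (hann b).1 (h2 a b hab ((hann a).2 ha))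
  have hr' : (addOrderOf y : ZMod n) * r = 0 := (hann r).1 (hy r ((spectralSetoid G).refl' r))
  have hyd : addOrderOf y ∣ d := by
    have : (d : ZMod n) * y = 0 := ((hD d).1 hd).2 r y hry hr
    rw [← nsmul_eq_mul] at this
    exact addOrderOf_dvd_of_nsmul_eq_zero this
  by_contra hne
  have hd0 : 0 < d := Nat.pos_of_dvd_of_pos ((hD d).1 hd).1 (NeZero.pos n)
  have hlt : addOrderOf y < d := lt_of_le_of_ne (Nat.le_of_dvd hd0 hyd) hne
  have hex : ∃ k ≤ d, (fun l => l ∈ D ∧ addOrderOf y ∣ l ∧ l ∣ d ∧ l < d) k :=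
    ⟨_, hlt.le, hyD, dvd_rfl, hyd, hlt⟩
  obtain ⟨m, ⟨hmD, hym, hmd, hmlt⟩, hmax⟩ : ∃ m, (m ∈ D ∧ addOrderOf y ∣ m ∧ m ∣ d ∧ m < d) ∧
      ∀ l, (l ∈ D ∧ addOrderOf y ∣ l ∧ l ∣ d ∧ l < d) → l ≤ m := by
    obtain ⟨k, hk, hk'⟩ := hex
    refine ⟨_, Nat.findGreatest_spec (P := fun l => l ∈ D ∧ addOrderOf y ∣ l ∧ l ∣ d ∧ l < d) hk hk',
      fun l hl => Nat.le_findGreatest hl.2.2.2.le hl⟩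
  refine hcov m ⟨hd, hmD, hmd, hmlt, ?_⟩ ?_
  · rintro ⟨l, hlD, h1, h2, h3, h4⟩
    exact absurd (hmax l ⟨hlD, hym.trans h3, h4, h2⟩) (not_le.2 h1)
  · obtain ⟨c, rfl⟩ := hym
    rw [Nat.cast_mul, mul_right_comm, hr', zero_mul]

theorem exists_mem_forall_covers {m : ℕ} {D : Set ℕ} (hm : m ∈ D) {r : ZMod m} (hr : r ≠ 0) :
    ∃ d ∈ D, d ≠ 1 ∧ (d : ZMod m) * r = 0 ∧
      ∀ d', DivisorCovers D d d' → (d' : ZMod m) * r ≠ 0 := by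
  classical
  have hex : ∃ d, d ∈ D ∧ (d : ZMod m) * r = 0 := ⟨m, hm, by simp⟩
  obtain ⟨h1, h2⟩ := Nat.find_spec hex
  -- The least `d` in `D` annihilating `r` works: anything it covers is smaller.
  refine ⟨Nat.find hex, h1, fun h => hr (by simpa [h] using h2), h2, fun d' hd' hd'r => ?_⟩
  exact Nat.find_min hex hd'.2.2.2.1 ⟨hd'.2.1, hd'r⟩

/-- If for every `d ≠ 1` in `D` some frequency of exact level `d` occurs in `δ`, then every non-zero
frequency occurs in some translate of `δ` under `G`. -/
theorem exists_fourierCoeffComp_ne_zero (hG : Equiv.addRight (1 : ZMod n) ∈ G) {D : Set ℕ}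
    (hD : ∀ d, d ∈ D ↔ d ∣ n ∧ (spectralSetoid G).IsSaturated {r | (d : ZMod n) * r = 0})
    {δ : ZMod n → ℚ}
    (hδ : ∀ d ∈ D, d ≠ 1 → ∃ r : ZMod n, (d : ZMod n) * r = 0 ∧
      (∀ d', DivisorCovers D d d' → (d' : ZMod n) * r ≠ 0) ∧ fourierCoeffComp δ 1 r ≠ 0)
    {r : ZMod n} (hr : r ≠ 0) : ∃ h ∈ G, fourierCoeffComp δ h r ≠ 0 := by
  have hn : n ∈ D := by
    rw [hD]
    exact ⟨dvd_rfl, fun _ _ _ _ => by simp⟩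
  obtain ⟨d, hd, hd1, hdr, hcov⟩ := exists_mem_forall_covers hn hr
  obtain ⟨s, hds, hscov, hs⟩ := hδ d hd hd1
  obtain ⟨y, hy, hyd⟩ := exists_addOrderOf_eq hD hd hdr hcov
  obtain ⟨z, hz, hzd⟩ := exists_addOrderOf_eq hD hd hds hscov
  have hyz := isRationalSchurRing_spectralSetoid (G := G).rel_of_addOrderOf_eq (hyd.trans hzd.symm)
  have hrs : spectralSetoid G r s :=
    (spectralSetoid G).trans' hy ((spectralSetoid G).trans' hyz ((spectralSetoid G).symm' hz))
  by_contra! hcon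
  exact hs (isSaturated_fourierCoeffComp_eq_zero hG δ r s hrs hcon 1 (one_mem G))

end Divisors

end ZMod

/-! ### Analytic continuation and decomposition of polynomials -/

namespace Polynomial
open Topology unitInterval

theorem exists_local_inverse (P : ℂ[X]) {x : ℂ} (hx : P.derivative.eval x ≠ 0) :
    ∃ ψ : ℂ → ℂ, AnalyticAt ℂ ψ (P.eval x) ∧ (∀ᶠ w in 𝓝 (P.eval x), P.eval (ψ w) = w) ∧
      ∀ᶠ y in 𝓝 x, ψ (P.eval y) = y := by
  have ha : AnalyticAt ℂ (fun y => P.eval y) x := AnalyticOnNhd.eval_polynomial P x (Set.mem_univ x)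
  have hd' : deriv (fun y => P.eval y) x ≠ 0 := by rwa [Polynomial.deriv]
  exact ⟨_, ha.analyticAt_localInverse hd',
    ha.hasStrictDerivAt.eventually_right_inverse hd', ha.hasStrictDerivAt.eventually_left_inverse hd'⟩

theorem eventuallyEq_of_local_sections (P : ℂ[X]) {φ φ' : ℂ → ℂ} {w : ℂ}
    (hw : P.derivative.eval (φ w) ≠ 0) (h : φ w = φ' w) (hφ : ContinuousAt φ w)
    (hφ' : ContinuousAt φ' w) (hP : ∀ᶠ z in 𝓝 w, P.eval (φ z) = z)
    (hP' : ∀ᶠ z in 𝓝 w, P.eval (φ' z) = z) : φ =ᶠ[𝓝 w] φ' := by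
  obtain ⟨ψ, -, -, hψ⟩ := P.exists_local_inverse hw
  have h' := hψ
  rw [h] at h'
  filter_upwards [hφ.eventually hψ, hφ'.eventually h', hP, hP'] with z h1 h2 h3 h4
  rw [← h1, ← h2, h3, h4]

/-- Analytic continuation of a linear relation between the values of `Q` at the branches of the
inverse of `P` along the lifts of a path. -/
theorem eventually_sum_eq_zero_of_lifts {ι : Type*} [Fintype ι] (P Q : ℂ[X]) (c : ι → ℂ)
    (γ : I → ℂ) (hγ : ∀ t, γ t ∈ AbelianIntegral.regularValues P) (Γ : ι → I → ℂ)
    (hcont : ∀ i, Continuous (Γ i)) (hΓ : ∀ i t, P.eval (Γ i t) = γ t) (hγc : Continuous γ)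
    {φ₀ φ₁ : ι → ℂ → ℂ}
    (h₀ : ∀ i, φ₀ i (γ 0) = Γ i 0 ∧ ContinuousAt (φ₀ i) (γ 0) ∧
      ∀ᶠ w in 𝓝 (γ 0), P.eval (φ₀ i w) = w)
    (h₁ : ∀ i, φ₁ i (γ 1) = Γ i 1 ∧ ContinuousAt (φ₁ i) (γ 1) ∧
      ∀ᶠ w in 𝓝 (γ 1), P.eval (φ₁ i w) = w)
    (hsum : ∀ᶠ w in 𝓝 (γ 0), ∑ i, c i * Q.eval (φ₀ i w) = 0) :
    ∀ᶠ w in 𝓝 (γ 1), ∑ i, c i * Q.eval (φ₁ i w) = 0 := by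
  have hreg : ∀ i t, P.derivative.eval (Γ i t) ≠ 0 := fun i t h0 => hγ t ⟨Γ i t, hΓ i t, h0⟩
  -- Germs of sections through the points `Γ i t` are unique, so any one choice of sections decides
  -- this property.
  let Vanishes : I → Prop := fun t => ∀ φ : ι → ℂ → ℂ,
    (∀ i, φ i (γ t) = Γ i t ∧ ContinuousAt (φ i) (γ t) ∧ ∀ᶠ w in 𝓝 (γ t), P.eval (φ i w) = w) →
    ∀ᶠ w in 𝓝 (γ t), ∑ i, c i * Q.eval (φ i w) = 0
  have hiff : ∀ t (φ : ι → ℂ → ℂ),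
      (∀ i, φ i (γ t) = Γ i t ∧ ContinuousAt (φ i) (γ t) ∧
        ∀ᶠ w in 𝓝 (γ t), P.eval (φ i w) = w) →
      (Vanishes t ↔ ∀ᶠ w in 𝓝 (γ t), ∑ i, c i * Q.eval (φ i w) = 0) := by
    intro t φ hφ
    refine ⟨fun h => h φ hφ, fun h φ' hφ' => ?_⟩
    have : ∀ᶠ w in 𝓝 (γ t), ∀ i, φ i w = φ' i w := Filter.eventually_all.2 fun i =>
      P.eventuallyEq_of_local_sections (by rw [(hφ i).1]; exact hreg i t)
        ((hφ i).1.trans (hφ' i).1.symm) (hφ i).2.1 (hφ' i).2.1 (hφ i).2.2 (hφ' i).2.2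
    filter_upwards [h, this] with w h1 h2
    simpa only [h2] using h1
  have hloc : IsLocallyConstant Vanishes := by
    rw [IsLocallyConstant.iff_eventually_eq]
    intro t
    choose ψ hψa hψr hψl using fun i => P.exists_local_inverse (hreg i t)
    simp only [hΓ] at hψa hψr
    have hFa : AnalyticAt ℂ (fun w => ∑ i, c i * Q.eval (ψ i w)) (γ t) := by
      refine Finset.analyticAt_fun_sum _ fun i _ => analyticAt_const.mul ?_
      exact (AnalyticOnNhd.eval_polynomial Q (ψ i (γ t)) (Set.mem_univ _)).comp (hψa i)
    obtain ⟨ρ, hρ, hball⟩ := Metric.eventually_nhds_iff_ball.1 hFa.eventually_analyticAt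
    -- By the identity theorem, vanishing near one point of the ball is vanishing on all of it,
    -- which makes `Vanishes` locally constant on the connected interval.
    have hzero : ∀ s, γ s ∈ Metric.ball (γ t) ρ →
        ((∀ᶠ w in 𝓝 (γ s), ∑ i, c i * Q.eval (ψ i w) = 0) ↔
          ∀ w ∈ Metric.ball (γ t) ρ, ∑ i, c i * Q.eval (ψ i w) = 0) := by
      intro s hs
      refine ⟨fun h => ?_, fun h => ?_⟩
      · exact AnalyticOnNhd.eqOn_zero_of_preconnected_of_eventuallyEq_zero hball
          (convex_ball _ _).isPreconnected hs h
      · filter_upwards [Metric.isOpen_ball.mem_nhds hs] with w hw using h w hw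
    have hsec : ∀ᶠ s in 𝓝 t, γ s ∈ Metric.ball (γ t) ρ ∧ ∀ i, ψ i (γ s) = Γ i s ∧
        ContinuousAt (ψ i) (γ s) ∧ ∀ᶠ w in 𝓝 (γ s), P.eval (ψ i w) = w := by
      refine (hγc.continuousAt.eventually (Metric.ball_mem_nhds _ hρ)).and
        (Filter.eventually_all.2 fun i => ?_)
      filter_upwards [(hcont i).continuousAt.eventually (hψl i),
        hγc.continuousAt.eventually (hψa i).eventually_analyticAt,
        hγc.continuousAt.eventually (eventually_eventually_nhds.2 (hψr i))] with s h1 h2 h3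
      exact ⟨by rw [← hΓ i s]; exact h1, h2.continuousAt, h3⟩
    have ht := hsec.self_of_nhds
    filter_upwards [hsec] with s hs
    rw [eq_iff_iff, hiff s ψ hs.2, hiff t ψ ht.2, hzero s hs.1, hzero t ht.1]
  have h01 : Vanishes 0 = Vanishes 1 := hloc.apply_eq_of_preconnectedSpace 0 1
  exact (hiff 1 φ₁ h₁).1 (h01 ▸ (hiff 0 φ₀ h₀).2 hsum)

/-- The `n` distinct points exhaust the roots of `P - C w`, which is a unit times `∏ (X - C (x i))`.
-/
theorem sub_C_dvd_sub_C_of_injective {P Q : ℂ[X]} {n : ℕ} (hn : 0 < n) (hP : P.natDegree = n)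
    {x : Fin n → ℂ} (hx : Function.Injective x) {w c : ℂ} (hPx : ∀ i, P.eval (x i) = w)
    (hQx : ∀ i, Q.eval (x i) = c) : P - C w ∣ Q - C c := by
  have hdvd : ∀ {F : ℂ[X]} {a : ℂ}, (∀ i, F.eval (x i) = a) →
      ∏ i, (X - C (x i)) ∣ F - C a := by
    intro F a hF
    refine Finset.prod_dvd_of_coprime (fun i _ j _ hij => ?_) fun i _ => ?_
    · exact pairwise_coprime_X_sub_C hx hij
    · rw [dvd_iff_isRoot, IsRoot.def, eval_sub, eval_C, hF i, sub_self]
  obtain ⟨A, hA⟩ := hdvd hPx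
  have hdeg : (P - C w).natDegree = n := by rw [natDegree_sub_C, hP]
  have h0 : P - C w ≠ 0 := by
    intro h
    rw [h, natDegree_zero] at hdeg
    omega
  have hA0 : A ≠ 0 := by
    rintro rfl
    exact h0 (by rw [hA, mul_zero])
  have hmonic : (∏ i, (X - C (x i))).Monic := monic_prod_of_monic _ _ fun i _ => monic_X_sub_C _
  have hA1 : IsUnit A := by
    rw [isUnit_iff_degree_eq_zero, degree_eq_natDegree hA0]
    rw [hA, hmonic.natDegree_mul' hA0, natDegree_prod_of_monic _ _ fun i _ => monic_X_sub_C _]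
      at hdeg
    simp only [natDegree_X_sub_C, Finset.sum_const, Finset.card_univ, Fintype.card_fin,
      smul_eq_mul, mul_one] at hdeg
    have : A.natDegree = 0 := by omega
    rw [this, Nat.cast_zero]
  rw [hA, hA1.mul_right_dvd]
  exact hdvd hQx

/-- A polynomial that is constant on infinitely many simple fibres of `P` is a polynomial in
`P`. -/
theorem exists_eq_comp_of_constant_on_fibres {P : ℂ[X]} {n : ℕ} (hn : 0 < n)
    (hP : P.natDegree = n) (x : Fin n → ℂ → ℂ) : ∀ (N : ℕ) (Q : ℂ[X]) (T : Set ℂ),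
    Q.natDegree = N → T.Infinite → (∀ w ∈ T, Function.Injective fun i => x i w) →
    (∀ w ∈ T, ∀ i, P.eval (x i w) = w) → (∀ w ∈ T, ∀ i j, Q.eval (x i w) = Q.eval (x j w)) →
    ∃ R : ℂ[X], Q = R.comp P := by
  intro N
  induction N using Nat.strong_induction_on with | _ N ih => ?_
  intro Q T hN hT hinj hPx hQx
  by_cases hN0 : N = 0
  · obtain ⟨c, rfl⟩ := natDegree_eq_zero.1 (hN.trans hN0)
    exact ⟨C c, by rw [C_comp]⟩
  obtain ⟨w₀, hw₀⟩ := hT.nonempty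
  obtain ⟨Q₁, hQ₁⟩ := sub_C_dvd_sub_C_of_injective hn hP (hinj w₀ hw₀) (hPx w₀ hw₀)
    (fun i => hQx w₀ hw₀ i ⟨0, hn⟩)
  set c := Q.eval (x ⟨0, hn⟩ w₀)
  have hdeg : Q₁.natDegree < N := by
    by_cases h0 : Q₁ = 0
    · rw [h0, natDegree_zero]; omega
    · have h1 : (Q - C c).natDegree = N := by rw [natDegree_sub_C, hN]
      have h2 : P - C w₀ ≠ 0 := by
        intro h
        have : (P - C w₀).natDegree = n := by rw [natDegree_sub_C, hP]
        rw [h, natDegree_zero] at this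
        omega
      rw [hQ₁, natDegree_mul h2 h0, natDegree_sub_C, hP] at h1
      omega
  -- Without `w₀`, the factor `w - w₀` cancels, so the quotient `Q₁` is again constant on the
  -- remaining fibres.
  obtain ⟨R₁, hR₁⟩ := ih _ hdeg Q₁ (T \ {w₀}) rfl (hT.sdiff (Set.finite_singleton _))
    (fun w hw => hinj w hw.1) (fun w hw => hPx w hw.1) (fun w hw i j => by
      have e : ∀ i, (w - w₀) * Q₁.eval (x i w) = Q.eval (x i w) - c := by
        intro i
        have := congrArg (eval (x i w)) hQ₁
        rw [eval_mul, eval_sub, eval_sub, eval_C, eval_C, hPx w hw.1] at this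
        exact this.symm
      exact mul_left_cancel₀ (sub_ne_zero.2 hw.2) (by rw [e, e, hQx w hw.1 i j]))
  refine ⟨C c + (X - C w₀) * R₁, ?_⟩
  rw [add_comp, mul_comp, sub_comp, X_comp, C_comp, C_comp, ← hR₁, ← hQ₁]
  ring

end Polynomial

/-! ### Translation to branches and the conclusion -/

namespace AbelianIntegral
open Topology

theorem natCast_mul_sub_eq_zero_iff {n d e : ℕ} [NeZero n] (hde : d * e = n) (i j : ZMod n) :
    (e : ZMod n) * (i - j) = 0 ↔ i.val ≡ j.val [MOD d] := by
  have he : e ≠ 0 := fun h => NeZero.ne n (by rw [← hde, h, mul_zero])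
  rw [mul_sub, sub_eq_zero]
  nth_rw 1 [← ZMod.natCast_zmod_val i, ← ZMod.natCast_zmod_val j]
  rw [← Nat.cast_mul, ← Nat.cast_mul, ZMod.natCast_eq_natCast_iff,
    ← Nat.ModEq.mul_left_cancel_iff' he (m := d), mul_comm e d, hde]

/-- The indicator of a residue class modulo `d` is a periodic vector that tests congruence. -/
theorem mem_invariantDivisors_iff {n : ℕ} {G : Subgroup (Equiv.Perm (Fin n))} {d : ℕ} :
    d ∈ invariantDivisors G ↔ d ∣ n ∧ ∀ g ∈ G, ∀ i j : Fin n,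
      (i : ℕ) ≡ j [MOD d] → (g i : ℕ) ≡ g j [MOD d] := by
  refine and_congr_right fun _ => ⟨fun h g hg i j hij => ?_, fun h g hg v hv i j hij => ?_⟩
  · classical
    have hv : (fun l : Fin n => if (l : ℕ) ≡ g j [MOD d] then (1 : ℚ) else 0) ∈
        periodicVectors n d := by
      intro a b hab
      have : (a : ℕ) ≡ g j [MOD d] ↔ (b : ℕ) ≡ g j [MOD d] :=
        ⟨fun h => hab.symm.trans h, fun h => hab.trans h⟩
      simp only [this]
    have := h g⁻¹ (inv_mem hg) _ hv i j hij
    simp only [Function.comp_apply, inv_inv] at this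
    by_contra hne
    rw [if_neg hne, if_pos (Nat.ModEq.refl _)] at this
    exact zero_ne_one this
  · exact hv _ _ (h g⁻¹ (inv_mem hg) i j hij)

theorem hermitian_rootVector {k : ℕ} (δ : Fin (k + 1) → ℚ) (r : ℕ) :
    hermitian δ (rootVector (k + 1) r) =
      ZMod.fourierCoeffComp (n := k + 1) δ 1 (r : ZMod (k + 1)) := by
  refine Finset.sum_congr rfl fun j _ => ?_
  rw [← ZMod.conj_stdAddChar]
  have : rootVector (k + 1) r j =
      ZMod.stdAddChar (N := k + 1) ((r : ZMod (k + 1)) * (show ZMod (k + 1) from j)) := by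
    have hj : ((j : ℕ) : ZMod (k + 1)) = j := ZMod.natCast_zmod_val (n := k + 1) j
    have := ZMod.stdAddChar_coe (N := k + 1) ((r * (j : ℕ) : ℕ) : ℤ)
    rw [Int.cast_natCast, Nat.cast_mul, hj] at this
    rw [this, rootVector, ← Complex.exp_nat_mul]
    congr 1
    push_cast
    ring
  rw [this]
  rfl

theorem mem_invariantDivisors_iff_isSaturated {k : ℕ} {G : Subgroup (Equiv.Perm (ZMod (k + 1)))}
    {d : ℕ} : d ∈ invariantDivisors (n := k + 1) G ↔
      d ∣ k + 1 ∧ (ZMod.spectralSetoid G).IsSaturated {r | (d : ZMod (k + 1)) * r = 0} := by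
  refine (mem_invariantDivisors_iff (n := k + 1)).trans (and_congr_right fun hd => ?_)
  have hde : d * ((k + 1) / d) = k + 1 := Nat.mul_div_cancel' hd
  rw [ZMod.isSaturated_annihilator_iff hde]
  simp only [natCast_mul_sub_eq_zero_iff hde]
  rfl

theorem addRight_one_eq_finRotate (k : ℕ) :
    Equiv.addRight (1 : ZMod (k + 1)) = finRotate (k + 1) :=
  Equiv.ext fun i => (finRotate_apply (n := k + 1) i).symm

theorem eq_of_forall_sum_comp_eq_zero {k : ℕ} {G : Subgroup (Equiv.Perm (Fin (k + 1)))}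
    (hG : finRotate (k + 1) ∈ G) {δ : Fin (k + 1) → ℚ}
    (hδ : ∀ d ∈ invariantDivisors G, d ≠ 1 →
      ∃ r ∈ psiSet G d, hermitian δ (rootVector (k + 1) r) ≠ 0)
    {q : Fin (k + 1) → ℂ} (hq : ∀ h ∈ G, ∑ i, (δ (h i) : ℂ) * q i = 0) (i j : Fin (k + 1)) :
    q i = q j := by
  have hG' := hG
  rw [← addRight_one_eq_finRotate] at hG'
  refine ZMod.eq_of_forall_sum_eq_zero (n := k + 1) (G := G) hG'
    (fun r hr => ZMod.exists_fourierCoeffComp_ne_zero (n := k + 1) (G := G) hG'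
      (D := invariantDivisors G) (fun _ => mem_invariantDivisors_iff_isSaturated) (fun d hd hd1 => ?_) hr) hq i j
  · obtain ⟨r, ⟨-, -, hdr, hcov⟩, hne⟩ := hδ d hd hd1
    have key : ∀ d, d ∣ k + 1 → ((d : ZMod (k + 1)) * (r : ZMod (k + 1)) = 0 ↔ (k + 1) / d ∣ r) := by
      intro d hd
      rw [← Nat.cast_mul, ZMod.natCast_eq_zero_iff]
      nth_rw 1 [← Nat.mul_div_cancel' hd]
      exact Nat.mul_dvd_mul_iff_left (Nat.pos_of_dvd_of_pos hd (Nat.succ_pos k))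
    refine ⟨r, (key d hd.1).2 hdr, fun d' hd' h => hcov d' hd' ((key d' hd'.2.1.1).1 h), ?_⟩
    rwa [← hermitian_rootVector]

variable {P : ℂ[X]} {n : ℕ}

theorem Branches.IsStandard.finRotate_mem {b : Branches P n} (hb : b.IsStandard) :
    finRotate n ∈ b.monodromyGroup := by
  obtain ⟨γ, ⟨w, α, k, -, hw, hα, -, rfl⟩, hγ⟩ := hb
  refine ⟨_, fun t => ?_, hγ⟩
  have hcirc : ∀ t, circlePath w k t ∈ regularValues P := by
    intro t ht
    have := hw _ ht
    have e : ‖circlePath w k t‖ = ‖w‖ := by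
      change ‖w * Complex.exp (k * (2 * Real.pi * Complex.I) * ((t : ℝ) : ℂ))‖ = ‖w‖
      have : (k * (2 * Real.pi * Complex.I) * ((t : ℝ) : ℂ)) =
          ((k * (2 * Real.pi) * t : ℝ) : ℂ) * Complex.I := by push_cast; ring
      rw [norm_mul, this, Complex.norm_exp_ofReal_mul_I, mul_one]
    exact absurd e this.ne
  rw [Path.trans_apply]
  split_ifs
  · rw [Path.trans_apply]
    split_ifs
    exacts [hα _, hcirc _]
  · exact hα _

theorem Branches.isLocalSection (b : Branches P n) (i : Fin n) {z : ℂ} (hz : z ∈ b.domain) :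
    ContinuousAt (b.branch i) z ∧ ∀ᶠ w in 𝓝 z, P.eval (b.branch i w) = w :=
  ⟨(b.continuousOn_branch i).continuousAt (b.isOpen_domain.mem_nhds hz), by
    filter_upwards [b.isOpen_domain.mem_nhds hz] with w hw using b.eval_branch i w hw⟩

theorem Branches.eventually_sum_perm_eq_zero (b : Branches P n) {σ : Equiv.Perm (Fin n)}
    (hσ : σ ∈ b.monodromyGroup) {Q : ℂ[X]} {δ : Fin n → ℚ}
    (hint : ∀ z ∈ b.domain, b.integral δ Q z = 0) :
    ∀ᶠ z in 𝓝 b.base, ∑ i, (δ i : ℂ) * Q.eval (b.branch (σ i) z) = 0 := by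
  obtain ⟨γ, hγ, hlift⟩ := hσ
  choose Γ hΓ using hlift
  have := P.eventually_sum_eq_zero_of_lifts Q (fun i => (δ i : ℂ)) γ hγ (fun i => Γ i)
    (fun i => (Γ i).continuous) hΓ γ.continuous (φ₀ := b.branch) (φ₁ := fun i => b.branch (σ i))
  simp only [γ.source, γ.target, Path.source, Path.target] at this
  refine this (fun i => ⟨trivial, b.isLocalSection i b.base_mem⟩)
    (fun i => ⟨trivial, b.isLocalSection (σ i) b.base_mem⟩) ?_
  filter_upwards [b.isOpen_domain.mem_nhds b.base_mem] with z hz using hint z hz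

end AbelianIntegral

theorem propositionp2 (P Q : ℂ[X]) (n : ℕ) (hn : 0 < n) (hP : P.natDegree = n)
    (b : AbelianIntegral.Branches P n) (hb : b.IsStandard)
    (δ : Fin n → ℚ) (hQ : Q ≠ 0)
    (hint : ∀ z ∈ b.domain, b.integral δ Q z = 0)
    (hδ : ∀ d ∈ AbelianIntegral.invariantDivisors b.monodromyGroup, d ≠ 1 →
      ∃ r ∈ AbelianIntegral.psiSet b.monodromyGroup d,
        AbelianIntegral.hermitian δ (AbelianIntegral.rootVector n r) ≠ 0) :
    (∃ R : ℂ[X], Q = R.comp P) ∧ AbelianIntegral.IsReduced δ := by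
  obtain ⟨T, hT, hTopen, hbT, hsum⟩ : ∃ T ⊆ b.domain, IsOpen T ∧ b.base ∈ T ∧
      ∀ z ∈ T, ∀ σ : b.monodromyGroup,
        ∑ i, (δ i : ℂ) * Q.eval (b.branch (σ.1 i) z) = 0 := by
    -- The monodromy group is finite, so one neighbourhood serves all its elements.
    have h1 := (Filter.eventually_all (ι := b.monodromyGroup)).2
      fun σ => b.eventually_sum_perm_eq_zero σ.2 hint
    obtain ⟨T, hT, hTo, hbT⟩ := eventually_nhds_iff.1
      (h1.and (b.isOpen_domain.mem_nhds b.base_mem))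
    exact ⟨T, fun z hz => (hT z hz).2, hTo, hbT, fun z hz => (hT z hz).1⟩
  have hinf : T.Infinite := infinite_of_mem_nhds b.base (hTopen.mem_nhds hbT)
  have hconst : ∀ z ∈ T, ∀ i j, Q.eval (b.branch i z) = Q.eval (b.branch j z) := by
    intro z hz i j
    cases n with
    | zero => exact i.elim0
    | succ k =>
      refine AbelianIntegral.eq_of_forall_sum_comp_eq_zero hb.finRotate_mem hδ
        (q := fun i => Q.eval (b.branch i z)) (fun h hh => ?_) i j
      -- Reindexing moves `h` from `δ` to the branches as `h⁻¹`.
      rw [← hsum z hz ⟨h⁻¹, inv_mem hh⟩]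
      refine (Equiv.sum_comp h _).symm.trans ?_ |>.symm
      simp
  obtain ⟨R, hR⟩ := exists_eq_comp_of_constant_on_fibres hn hP b.branch _ Q T rfl hinf
    (fun w hw => b.injective_branch w (hT hw)) (fun w hw i => b.eval_branch i w (hT hw)) hconst
  refine ⟨⟨R, hR⟩, ?_⟩
  have hR0 : R ≠ 0 := by
    rintro rfl
    exact hQ (by rw [hR, zero_comp])
  obtain ⟨z, hzT, hz⟩ : ∃ z ∈ T, R.eval z ≠ 0 := by
    by_contra! hcon
    exact hR0 (eq_zero_of_infinite_isRoot R (hinf.mono hcon))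
  have h0 := hint z (hT hzT)
  rw [AbelianIntegral.Branches.integral, Finset.sum_congr rfl fun i _ => by
    rw [hR, eval_comp, b.eval_branch i z (hT hzT)], ← Finset.sum_mul] at h0
  have h1 := (mul_eq_zero.1 h0).resolve_right hz
  rw [AbelianIntegral.IsReduced]
  exact_mod_cast h1
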